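/- Let a *Ferrers board* $F$ be a finite set of squares $(i,j)$ ($i$-th column from the left, $j$-th row from the bottom) such that $(i,j)\in F$ implies $(i',j')\in F$ for all $i'\le i$, $j'\le j$. A *rook placement* on $F$ is a set $P\subseteq F$ of squares (the squares with a marker) with at most one square in each row and at most one in each column. Fix $k\ge 2$. An *occurrence of $k\ldots 1$* in $P$ is a sequence of squares $(i_1,r_1),\ldots,(i_k,r_k)$ in $P$ with $i_1<\cdots<i_k$ and $r_1>\cdots>r_k$, all contained in some rectangle of squares that is a subset of $F$. Occurrences are ordered lexicographically by their row sequences $(r_1,\ldots,r_k)$. If $P$ has an occurrence of $k\ldots1$, let $\phi(P)$ be obtained from $P$ by replacing the squares of the smallest occurrence by $(i_1,r_2),(i_2,r_3),\ldots,(i_{k-1},r_k),(i_k,r_1)$; again this is a rook placement on $F$. Let $\phi^*(P)$ be the result of applying $\phi$ repeatedly to $P$ until no occurrence of $k\ldots 1$ remains (this takes finitely many steps). *Fomin's growth diagram algorithm* ($GDA$) assigns a partition to every corner of every square of $F$. Corners on the left and bottom edges of $F$ get the empty partition. If the southwest, northwest and southeast corners of a square have been assigned $SW$, $NW$, $SE$,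 its northeast corner gets the partition $NE$ determined by these rules (absent entries are regarded as $0$): 1. If $NW\ne SE$, then $NE=NW\cup SE$, whose $i$-th entry is the maximum of the $i$-th entries of $NW$ and $SE$. 2. If $SW\ne NW=SE$, then $NW$ is obtained from $SW$ by adding $1$ to the $i$-th entry for some $i$, and $NE$ is obtained from $NW$ by adding $1$ to the $(i+1)$-th entry. 3. If $SW=NW=SE$, then $NE=SW$ unless the square contains a marker, in which case $NE$ is obtained from $SW$ by adding $1$ to the first entry. The *modified algorithm* $GDA_k$ is the same, except that whenever rule 2 produces a partition $NE$ with $k$ nonzero entries, the last of these entries is deleted and the first entry is increased by $1$. Let $\mathrm{seq}(P,F)$ (respectively $\mathrm{seq}_k(P,F)$) be the sequence of partitions along the right/up border of $F$, from the top of the left edge to the right end of the bottom edge, that results from applying $GDA$ (respectively $GDA_k$) to $P$ and $F$. **Theorem.** For every $k\ge2$, every Ferrers board $F$ and every rook placement $P$ on $F$, $$\mathrm{seq}_k(P,F)=\mathrm{seq}(\phi^*(P),F).$$ -/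

import Mathlib

/-! Ferrers boards are Mathlib's `YoungDiagram`s, i.e. finite lower sets of `ℕ × ℕ`.  They are drawn
in French notation: the square `(i, j)` lies in the `i`-th column from the left and in the `j`-th
row from the bottom, both counted from `0`.  With this reading `F.rowLen i` (the number of squares
of `F` with first coordinate `i`) is the height of column `i`, and `F.colLen 0` is the number of
columns of `F`. -/

/-- A rook placement on the Ferrers board `F`: a set of squares of `F` with at most one square in
each column and at most one square in each row. -/
@[ext]
structure RookPlacement (F : YoungDiagram) where
  squares : Finset (ℕ × ℕ)
  subset_board : squares ⊆ F.cells
  col_injOn : Set.InjOn Prod.fst (squares : Set (ℕ × ℕ))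
  row_injOn : Set.InjOn Prod.snd (squares : Set (ℕ × ℕ))

namespace RookPlacement

variable {F : YoungDiagram}

/-- `D 0, …, D (k-1)` (from left to right) is an occurrence of the pattern `k … 1` in `P`: its
squares are markers of `P`, the columns increase, the rows decrease, and some rectangular subboard
of `F` contains all the squares `D t`.  (In `ℕ × ℕ` the interval `Finset.Icc u v` is the
rectangle with southwest square `u` and northeast square `v`.) -/
structure IsOccurrence {k : ℕ} (P : RookPlacement F) (D : Fin k → ℕ × ℕ) : Prop where
  mem : ∀ t, D t ∈ P.squares
  col_strictMono : StrictMono fun t => (D t).1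
  row_strictAnti : StrictAnti fun t => (D t).2
  rectangle : ∃ u v : ℕ × ℕ, Finset.Icc u v ⊆ F.cells ∧ ∀ t, D t ∈ Finset.Icc u v

/-- `P` contains the pattern `k … 1`. -/
def ContainsDecreasing (k : ℕ) (P : RookPlacement F) : Prop :=
  ∃ D : Fin k → ℕ × ℕ, P.IsOccurrence D

/-- `D` is the smallest occurrence of `k … 1` in `P`, occurrences being ordered lexicographically
by their sequences of rows, read from left to right. -/
def IsSmallestOccurrence {k : ℕ} (P : RookPlacement F) (D : Fin k → ℕ × ℕ) : Prop :=
  P.IsOccurrence D ∧ ∀ E : Fin k → ℕ × ℕ, P.IsOccurrence E →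
    toLex (fun t => (D t).2) ≤ toLex (fun t => (E t).2)

theorem exists_smallestOccurrence {k : ℕ} {P : RookPlacement F} (h : P.ContainsDecreasing k) :
    ∃ D : Fin k → ℕ × ℕ, P.IsSmallestOccurrence D := by
  obtain ⟨D, hD, hmin⟩ := WellFounded.has_min
    (InvImage.wf (fun D : Fin k → ℕ × ℕ => toLex (fun t => (D t).2))
      (wellFounded_lt (α := Lex (Fin k → ℕ)))) {D | P.IsOccurrence D} h
  exact ⟨D, hD, fun E hE => not_lt.mp (hmin E hE)⟩

/-- The squares that replace an occurrence `D` of `k … 1`: the square in the column of `D t` is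
moved to the row of `D (t + 1)`, with `t + 1` taken modulo `k`. -/
def shifted {k : ℕ} (D : Fin k → ℕ × ℕ) (t : Fin k) : ℕ × ℕ :=
  ((D t).1, (D (finRotate k t)).2)

/-- The placement obtained from `P` by replacing the squares of an occurrence `D` of `k … 1`, in
rows `r₁ > r₂ > … > r_k`, by the squares in the same columns and in rows `r₂, …, r_k, r₁`,
respectively. -/
def replaceOccurrence {k : ℕ} (P : RookPlacement F) (D : Fin k → ℕ × ℕ) (hD : P.IsOccurrence D) :
    RookPlacement F where
  squares := (P.squares \ Finset.univ.image D) ∪ Finset.univ.image (shifted D)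
  subset_board := by
    obtain ⟨u, v, huv, hD'⟩ := hD.rectangle
    intro s hs
    rcases Finset.mem_union.mp hs with hs | hs
    · exact P.subset_board (Finset.mem_sdiff.mp hs).1
    · obtain ⟨t, -, rfl⟩ := Finset.mem_image.mp hs
      have h1 := Finset.mem_Icc.mp (hD' t)
      have h2 := Finset.mem_Icc.mp (hD' (finRotate k t))
      exact huv (Finset.mem_Icc.mpr ⟨⟨h1.1.1, h2.1.2⟩, ⟨h1.2.1, h2.2.2⟩⟩)
  col_injOn := by
    have key : ∀ s ∈ P.squares, s ∉ Finset.univ.image D → ∀ t, s.1 ≠ (D t).1 := by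
      intro s hs hsD t hst
      exact hsD (Finset.mem_image.mpr ⟨t, Finset.mem_univ _,
        (P.col_injOn hs (hD.mem t) hst).symm⟩)
    intro s hs s' hs' h
    simp only [Finset.coe_union, Set.mem_union, Finset.mem_coe, Finset.mem_sdiff] at hs hs'
    rcases hs with hs | hs <;> rcases hs' with hs' | hs'
    · exact P.col_injOn hs.1 hs'.1 h
    · obtain ⟨t, -, rfl⟩ := Finset.mem_image.mp hs'
      exact absurd h (key s hs.1 hs.2 t)
    · obtain ⟨t, -, rfl⟩ := Finset.mem_image.mp hs
      exact absurd h.symm (key s' hs'.1 hs'.2 t)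
    · obtain ⟨t, -, rfl⟩ := Finset.mem_image.mp hs
      obtain ⟨t', -, rfl⟩ := Finset.mem_image.mp hs'
      rw [hD.col_strictMono.injective h]
  row_injOn := by
    have key : ∀ s ∈ P.squares, s ∉ Finset.univ.image D → ∀ t, s.2 ≠ (D t).2 := by
      intro s hs hsD t hst
      exact hsD (Finset.mem_image.mpr ⟨t, Finset.mem_univ _,
        (P.row_injOn hs (hD.mem t) hst).symm⟩)
    intro s hs s' hs' h
    simp only [Finset.coe_union, Set.mem_union, Finset.mem_coe, Finset.mem_sdiff] at hs hs'
    rcases hs with hs | hs <;> rcases hs' with hs' | hs'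
    · exact P.row_injOn hs.1 hs'.1 h
    · obtain ⟨t, -, rfl⟩ := Finset.mem_image.mp hs'
      exact absurd h (key s hs.1 hs.2 _)
    · obtain ⟨t, -, rfl⟩ := Finset.mem_image.mp hs
      exact absurd h.symm (key s' hs'.1 hs'.2 _)
    · obtain ⟨t, -, rfl⟩ := Finset.mem_image.mp hs
      obtain ⟨t', -, rfl⟩ := Finset.mem_image.mp hs'
      rw [(finRotate k).injective (hD.row_strictAnti.injective h)]

open Classical in
/-- The map `φ`: apply the replacement above to the smallest occurrence of `k … 1` in `P`, if
there is any. -/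
noncomputable def phi (k : ℕ) (P : RookPlacement F) : RookPlacement F :=
  if h : P.ContainsDecreasing k then
    P.replaceOccurrence (exists_smallestOccurrence h).choose
      (exists_smallestOccurrence h).choose_spec.1
  else P

/-- A quantity that decreases under `φ`; it is only used to see that the iteration of `φ` stops. -/
def weight (P : RookPlacement F) : ℕ :=
  ∑ s ∈ P.squares, (F.cells.sup Prod.fst - s.1) * s.2

theorem weight_replaceOccurrence_lt {k : ℕ} (hk : 2 ≤ k) (P : RookPlacement F)
    (D : Fin k → ℕ × ℕ) (hD : P.IsOccurrence D) :
    (P.replaceOccurrence D hD).weight < P.weight := by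
  have hle : ∀ t, (D t).1 ≤ F.cells.sup Prod.fst := fun t =>
    Finset.le_sup (f := Prod.fst) (P.subset_board (hD.mem t))
  have hDinj : Function.Injective D := fun a b h =>
    hD.col_strictMono.injective (congrArg Prod.fst h)
  have hS : Function.Injective (shifted D) := by
    intro a b h
    have h' : (D a).1 = (D b).1 := (Prod.ext_iff.mp h).1
    exact hD.col_strictMono.injective h'
  have hsub : Finset.univ.image D ⊆ P.squares := by
    intro s hs
    obtain ⟨t, -, rfl⟩ := Finset.mem_image.mp hs
    exact hD.mem t
  set w : ℕ × ℕ → ℕ := fun s => (F.cells.sup Prod.fst - s.1) * s.2 with hw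
  have hmono : Monovary (fun t => F.cells.sup Prod.fst - (D t).1) (fun t => (D t).2) := by
    intro a b hab
    have h1 : b < a := hD.row_strictAnti.lt_iff_gt.mp hab
    have h2 := hD.col_strictMono h1
    simp only at h2 ⊢
    omega
  have hlt : ∑ t, w (shifted D t) < ∑ t, w (D t) := by
    refine (hmono.sum_mul_comp_perm_lt_sum_mul_iff (σ := finRotate k)).mpr ?_
    intro hcon
    obtain ⟨n, rfl⟩ : ∃ n, k = n + 2 := ⟨k - 2, by omega⟩
    have h01 : (0 : Fin (n + 2)) < Fin.last (n + 1) := Fin.last_pos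
    have hr : (D (finRotate (n + 2) 0)).2 < (D (finRotate (n + 2) (Fin.last (n + 1)))).2 := by
      rw [finRotate_last, finRotate_apply, zero_add]
      exact hD.row_strictAnti Fin.zero_lt_one
    have h1 := hcon hr
    have h2 := hD.col_strictMono h01
    have h3 := hle 0
    have h4 := hle (Fin.last (n + 1))
    simp only at h1 h2
    omega
  have hold : P.weight = ∑ s ∈ P.squares \ Finset.univ.image D, w s + ∑ t, w (D t) := by
    rw [← Finset.sum_image (f := w) (s := Finset.univ) (g := D) (fun a _ b _ h => hDinj h),
      Finset.sum_sdiff hsub]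
    rfl
  have hnew : (P.replaceOccurrence D hD).weight
      ≤ ∑ s ∈ P.squares \ Finset.univ.image D, w s + ∑ t, w (shifted D t) := by
    rw [← Finset.sum_image (f := w) (s := Finset.univ) (g := shifted D) (fun a _ b _ h => hS h),
      ← Finset.sum_union_inter]
    exact Nat.le_add_right _ _
  omega

theorem weight_phi_lt {k : ℕ} (hk : 2 ≤ k) {P : RookPlacement F} (h : P.ContainsDecreasing k) :
    (P.phi k).weight < P.weight := by
  rw [phi, dif_pos h]
  exact weight_replaceOccurrence_lt hk P _ _

open Classical in
/-- The map `φ*`: apply `φ` repeatedly until no occurrence of `k … 1` remains. -/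
noncomputable def phiStar (k : ℕ) (hk : 2 ≤ k) (P : RookPlacement F) : RookPlacement F :=
  if _h : P.ContainsDecreasing k then phiStar k hk (P.phi k) else P
termination_by P.weight
decreasing_by exact weight_phi_lt hk _h

end RookPlacement

namespace GrowthDiagram

/-! Partitions are given by their sequences of entries, as elements of `ℕ →₀ ℕ`: the value at `i`
is the `(i+1)`-st entry, and the absence of an entry is the entry `0`. So the empty partition is
`0`, the number of (nonzero) entries of `μ` is `μ.support.card`, and `μ + Finsupp.single i 1` is
obtained from `μ` by adding `1` to the entry with index `i`. -/

open Classical in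
/-- Rule 2, applied when `SW ≠ NW = SE`: if `NW` is obtained from `SW` by adding `1` to one entry,
then `NE` is obtained from `NW` by adding `1` to the next entry.  (The last branch never
occurs in a growth diagram.) -/
noncomputable def ruleTwo (SW NW : ℕ →₀ ℕ) : ℕ →₀ ℕ :=
  if h : ∃ i, NW = SW + Finsupp.single i 1 then NW + Finsupp.single (h.choose + 1) 1 else NW

/-- Rule 2ₖ: apply rule 2; if this produces a partition with `k` nonzero entries, then delete the
last entry and increase the first entry by `1`. -/
noncomputable def ruleTwoMod (k : ℕ) (SW NW : ℕ →₀ ℕ) : ℕ →₀ ℕ :=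
  if (ruleTwo SW NW).support.card = k then
    (ruleTwo SW NW).erase (k - 1) + Finsupp.single 0 1
  else ruleTwo SW NW

/-- The partition at the northeast corner of a square, from the partitions at its other corners,
by rules 1, 2, 3, where `two` is the version of rule 2 in use and `marker` says whether the square
contains a marker.  The supremum in `ℕ →₀ ℕ` is the entrywise maximum. -/
noncomputable def northeast (two : (ℕ →₀ ℕ) → (ℕ →₀ ℕ) → (ℕ →₀ ℕ)) (marker : Prop)
    [Decidable marker] (SW NW SE : ℕ →₀ ℕ) : ℕ →₀ ℕ :=
  if NW ≠ SE then NW ⊔ SE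
  else if SW ≠ NW then two SW NW
  else if marker then SW + Finsupp.single 0 1
  else SW

/-- The partition at the lattice point `(i, j)`, where `(i, j)` is the southwest corner of the
square `(i, j)` and `(i + 1, j + 1)` is its northeast corner; it is empty on the left and bottom
edges.  (At a corner of a square of the board only squares of the board matter.) -/
noncomputable def corner (two : (ℕ →₀ ℕ) → (ℕ →₀ ℕ) → (ℕ →₀ ℕ)) (P : Finset (ℕ × ℕ)) :
    ℕ → ℕ → (ℕ →₀ ℕ)
  | 0, _ => 0
  | _ + 1, 0 => 0
  | i + 1, j + 1 => northeast two ((i, j) ∈ P)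
      (corner two P i j) (corner two P i (j + 1)) (corner two P (i + 1) j)

/-- The lattice points on the right/up border of `F`, from the top of the left edge to the right
end of the bottom edge: for each column `i`, the border first runs along the top of this column, to
`(i + 1, height of column i)`, and then down to `(i + 1, height of column i + 1)`. -/
def border (F : YoungDiagram) : List (ℕ × ℕ) :=
  (0, F.rowLen 0) :: (List.range (F.colLen 0)).flatMap fun i =>
    (List.range' (F.rowLen (i + 1)) (F.rowLen i - F.rowLen (i + 1) + 1)).reverse.map
      fun j => (i + 1, j)

/-- `seq(P, F)`: the partitions along the right/up border of `F` in the growth diagram of `P`. -/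
noncomputable def seq {F : YoungDiagram} (P : RookPlacement F) : List (ℕ →₀ ℕ) :=
  (border F).map fun c => corner ruleTwo P.squares c.1 c.2

/-- `seq_k(P, F)`: the partitions along the right/up border of `F` produced by the algorithm with
rule 2ₖ in place of rule 2. -/
noncomputable def seqMod (k : ℕ) {F : YoungDiagram} (P : RookPlacement F) : List (ℕ →₀ ℕ) :=
  (border F).map fun c => corner (ruleTwoMod k) P.squares c.1 c.2

end GrowthDiagram

/-! In the ordinary growth diagram the first entry at a corner is the length `lis` of a longest
increasing sequence of markers southwest of it (`corner_apply_zero`). Deleting all first entries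
leaves the growth diagram of another placement, the `skeleton`, formed by the inner corners of
Viennot's shadow lines (`tail_corner`). Along decreasing chains, markers and skeleton squares
interlace, so each passage to the skeleton shortens the longest decreasing chain by one; hence the
entry with index `n` is nonzero exactly when a decreasing chain of `n + 1` markers lies southwest of
the corner (`corner_apply_ne_zero_iff`). So both algorithms agree at a corner with no chain of
length `k` southwest of it (`corner_ruleTwoMod`), and they agree on the whole border once no
occurrence remains.

It remains to show that one step of `φ` preserves `seq_k`. Let `R` be the rectangle from the origin
to the last column and the first row of the smallest occurrence `D`. Within `R`, `D` is a longest
decreasing chain, and the componentwise least one. The map `φ` pushes each square of `D` but the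
last down to the row of its successor, and puts the last one in the northeast square of `R`. The
heart is `corner_pushed`: pushing alone preserves the ordinary partitions on the upper and right
sides of `R`, apart from the northeast corner. It is an induction on the length of the chain:
pushing changes `lis` only on boxes inside `R` (`lis_pushed`), and it acts on the skeleton as the
push along a shorter least chain with the same last column and first row (`skeleton_pushed`,
`Interlaced.leastChain`).

At the northeast corner of `R`, rule 2ₖ for `P` turns the new `k`-th entry into a `1` added to the
first entry, and the new marker of `φ(P)` adds the same `1` by rule 3. Beyond `R` the markers
coincide, so the partitions do too, and the border of `F` lies beyond `R`. -/

namespace GrowthDiagram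

/-! ### Longest increasing sequences and the runs of their level lines. -/

/-- At most one marker in each column and in each row. -/
structure IsRook (S : Finset (ℕ × ℕ)) : Prop where
  col : ∀ {a b c}, (a, b) ∈ S → (a, c) ∈ S → b = c
  row : ∀ {a b c}, (a, c) ∈ S → (b, c) ∈ S → a = b

/-- The length of a longest increasing sequence of markers southwest of the corner `(x, y)`. -/
def lis (S : Finset (ℕ × ℕ)) : ℕ → ℕ → ℕ
  | 0, _ => 0
  | _ + 1, 0 => 0
  | x + 1, y + 1 => max (max (lis S x (y + 1)) (lis S (x + 1) y))
      (lis S x y + if (x, y) ∈ S then 1 else 0)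

/-- The vertical edge from `(x, y)` to `(x, y + 1)` increases `lis`. -/
def Up (S : Finset (ℕ × ℕ)) (x y : ℕ) : Prop := lis S x (y + 1) = lis S x y + 1

/-- The horizontal edge from `(x, y)` to `(x + 1, y)` increases `lis`. -/
def Rt (S : Finset (ℕ × ℕ)) (x y : ℕ) : Prop := lis S (x + 1) y = lis S x y + 1

instance (S : Finset (ℕ × ℕ)) (x y : ℕ) : Decidable (Up S x y) := by unfold Up; infer_instance
instance (S : Finset (ℕ × ℕ)) (x y : ℕ) : Decidable (Rt S x y) := by unfold Rt; infer_instance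

variable {S : Finset (ℕ × ℕ)}

@[simp] theorem lis_zero_left (y : ℕ) : lis S 0 y = 0 := by cases y <;> simp [lis]

@[simp] theorem lis_zero_right (x : ℕ) : lis S x 0 = 0 := by cases x <;> simp [lis]

theorem lis_succ (x y : ℕ) : lis S (x + 1) (y + 1) =
    max (max (lis S x (y + 1)) (lis S (x + 1) y)) (lis S x y + if (x, y) ∈ S then 1 else 0) := by
  rw [lis]

theorem lis_succ_of_notMem {x y : ℕ} (h : (x, y) ∉ S) : lis S (x + 1) (y + 1) =
    max (max (lis S x (y + 1)) (lis S (x + 1) y)) (lis S x y) := by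
  rw [lis_succ, if_neg h, add_zero]

theorem lis_le_right (x y : ℕ) : lis S x y ≤ lis S (x + 1) y := by
  cases y with
  | zero => simp
  | succ y => rw [lis_succ]; omega

theorem lis_le_up (x y : ℕ) : lis S x y ≤ lis S x (y + 1) := by
  cases x with
  | zero => simp
  | succ x => rw [lis_succ]; omega

theorem lis_up_le (x y : ℕ) : lis S x (y + 1) ≤ lis S x y + 1 := by
  induction x with
  | zero => simp
  | succ x ih =>
    rw [lis_succ]
    have := lis_le_right (S := S) x y
    split_ifs <;> omega

theorem lis_right_le (x y : ℕ) : lis S (x + 1) y ≤ lis S x y + 1 := by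
  induction y with
  | zero => simp
  | succ y ih =>
    rw [lis_succ]
    have := lis_le_up (S := S) x y
    split_ifs <;> omega

theorem lis_up_eq {x y : ℕ} (h : ¬ Up S x y) : lis S x (y + 1) = lis S x y := by
  have := lis_le_up (S := S) x y
  have := lis_up_le (S := S) x y
  unfold Up at h
  omega

theorem lis_right_eq {x y : ℕ} (h : ¬ Rt S x y) : lis S (x + 1) y = lis S x y := by
  have := lis_le_right (S := S) x y
  have := lis_right_le (S := S) x y
  unfold Rt at h
  omega

/-- In a square without a marker, an increasing right edge forces an increasing left edge. So the
horizontal run of a shadow line can be followed to the left until it starts at a marker. -/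
theorem exists_of_up {x y : ℕ} (h : Up S x y) :
    ∃ a < x, (a, y) ∈ S ∧ ∀ z, a < z → z ≤ x → Up S z y := by
  induction x with
  | zero => simp [Up] at h
  | succ x ih =>
    by_cases hm : (x, y) ∈ S
    · refine ⟨x, by omega, hm, fun z hz hz' => ?_⟩
      obtain rfl : z = x + 1 := by omega
      exact h
    · have h1 : Up S x y := by
        have h0 := h
        unfold Up at h0 ⊢
        rw [lis_succ_of_notMem hm] at h0
        have := lis_le_right (S := S) x y
        have := lis_up_le (S := S) x y
        omega
      obtain ⟨a, ha, hmem, hall⟩ := ih h1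
      refine ⟨a, by omega, hmem, fun z hz hz' => ?_⟩
      rcases eq_or_lt_of_le hz' with rfl | hlt
      · exact h
      · exact hall z hz (by omega)

theorem exists_of_rt {x y : ℕ} (h : Rt S x y) :
    ∃ b < y, (x, b) ∈ S ∧ ∀ z, b < z → z ≤ y → Rt S x z := by
  induction y with
  | zero => simp [Rt] at h
  | succ y ih =>
    by_cases hm : (x, y) ∈ S
    · refine ⟨y, by omega, hm, fun z hz hz' => ?_⟩
      obtain rfl : z = y + 1 := by omega
      exact h
    · have h1 : Rt S x y := by
        have h0 := h
        unfold Rt at h0 ⊢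
        rw [lis_succ_of_notMem hm] at h0
        have := lis_le_up (S := S) x y
        have := lis_right_le (S := S) x y
        omega
      obtain ⟨a, ha, hmem, hall⟩ := ih h1
      refine ⟨a, by omega, hmem, fun z hz hz' => ?_⟩
      rcases eq_or_lt_of_le hz' with rfl | hlt
      · exact h
      · exact hall z hz (by omega)

theorem up_succ_of_not_rt {x y : ℕ} (h : Up S x y) (h' : ¬ Rt S x y) : Up S (x + 1) y := by
  have h1 := lis_right_eq h'
  have h2 := lis_le_right (S := S) x (y + 1)
  have h3 := lis_up_le (S := S) (x + 1) y
  unfold Up at h ⊢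
  omega

theorem rt_succ_of_not_up {x y : ℕ} (h : Rt S x y) (h' : ¬ Up S x y) : Rt S x (y + 1) := by
  have h1 := lis_up_eq h'
  have h2 := lis_le_up (S := S) (x + 1) y
  have h3 := lis_right_le (S := S) x (y + 1)
  unfold Rt at h ⊢
  omega

/-- If an increasing edge disappears between columns `x` and `z`, some square in between carries
both an increasing vertical and an increasing horizontal edge. -/
theorem exists_up_rt_of_up {x y z : ℕ} (hxz : x ≤ z) (h : Up S x y) (h' : ¬ Up S z y) :
    ∃ w, x ≤ w ∧ w < z ∧ Up S w y ∧ Rt S w y := by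
  induction z, hxz using Nat.le_induction with
  | base => exact absurd h h'
  | succ z hz ih =>
    by_cases hu : Up S z y
    · by_cases hr : Rt S z y
      · exact ⟨z, hz, by omega, hu, hr⟩
      · exact absurd (up_succ_of_not_rt hu hr) h'
    · obtain ⟨w, h1, h2, h3⟩ := ih hu
      exact ⟨w, h1, by omega, h3⟩

theorem exists_up_rt_of_rt {x y z : ℕ} (hyz : y ≤ z) (h : Rt S x y) (h' : ¬ Rt S x z) :
    ∃ w, y ≤ w ∧ w < z ∧ Up S x w ∧ Rt S x w := by
  induction z, hyz using Nat.le_induction with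
  | base => exact absurd h h'
  | succ z hz ih =>
    by_cases hr : Rt S x z
    · by_cases hu : Up S x z
      · exact ⟨z, hz, by omega, hu, hr⟩
      · exact absurd (rt_succ_of_not_up hr hu) h'
    · obtain ⟨w, h1, h2, h3⟩ := ih hr
      exact ⟨w, h1, by omega, h3⟩

namespace IsRook

theorem not_up (hS : IsRook S) {a x y : ℕ} (h : (a, y) ∈ S) (hx : x ≤ a) : ¬ Up S x y := by
  intro hu
  obtain ⟨a', ha', hm, -⟩ := exists_of_up hu
  have := hS.row h hm
  omega

theorem not_rt (hS : IsRook S) {b x y : ℕ} (h : (x, b) ∈ S) (hy : y ≤ b) : ¬ Rt S x y := by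
  intro hu
  obtain ⟨a', ha', hm, -⟩ := exists_of_rt hu
  have := hS.col h hm
  omega

theorem up_succ (hS : IsRook S) {a y : ℕ} (h : (a, y) ∈ S) : Up S (a + 1) y := by
  have h1 := lis_right_eq (hS.not_rt h le_rfl)
  have h3 := lis_up_le (S := S) (a + 1) y
  have h2 := lis_succ (S := S) a y
  rw [if_pos h] at h2
  unfold Up
  omega

theorem rt_succ (hS : IsRook S) {a y : ℕ} (h : (a, y) ∈ S) : Rt S a (y + 1) := by
  have h1 := lis_up_eq (hS.not_up h le_rfl)
  have h3 := lis_right_le (S := S) a (y + 1)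
  have h2 := lis_succ (S := S) a y
  rw [if_pos h] at h2
  unfold Rt
  omega

/-- The only marker of a row is the only place where a run can start, so the increasing edges of the
row form an interval beginning just right of it. -/
theorem up_of_up (hS : IsRook S) {a x y z : ℕ} (h : (a, y) ∈ S) (hz : Up S z y) (hx : a < x)
    (hxz : x ≤ z) : Up S x y := by
  obtain ⟨a', ha', hm, hall⟩ := exists_of_up hz
  obtain rfl := hS.row h hm
  exact hall x hx hxz

theorem rt_of_rt (hS : IsRook S) {b x y z : ℕ} (h : (x, b) ∈ S) (hz : Rt S x z) (hy : b < y)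
    (hyz : y ≤ z) : Rt S x y := by
  obtain ⟨a', ha', hm, hall⟩ := exists_of_rt hz
  obtain rfl := hS.col h hm
  exact hall y hy hyz

theorem lis_succ_of_up_rt (hS : IsRook S) {x y : ℕ} (hu : Up S x y) (hr : Rt S x y) :
    lis S (x + 1) (y + 1) = lis S x y + 1 := by
  have hm : (x, y) ∉ S := fun h => hS.not_up h le_rfl hu
  rw [lis_succ_of_notMem hm]
  unfold Up at hu
  unfold Rt at hr
  omega

end IsRook

/-! ### The skeleton. -/

/-- The squares where Fomin's second rule passes from the first entry to the second. -/
def skeleton (S : Finset (ℕ × ℕ)) : Finset (ℕ × ℕ) :=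
  (S.image Prod.fst ×ˢ S.image Prod.snd).filter fun p => Up S p.1 p.2 ∧ Rt S p.1 p.2

/-- The product of column and row sets in `skeleton` only provides finiteness: increasing edges need
a marker in their row or column. -/
theorem mem_skeleton {x y : ℕ} : (x, y) ∈ skeleton S ↔ Up S x y ∧ Rt S x y := by
  simp only [skeleton, Finset.mem_filter, Finset.mem_product, Finset.mem_image,
    and_iff_right_iff_imp]
  rintro ⟨hu, hr⟩
  obtain ⟨a, -, ha, -⟩ := exists_of_up hu
  obtain ⟨b, -, hb, -⟩ := exists_of_rt hr
  exact ⟨⟨_, hb, rfl⟩, ⟨_, ha, rfl⟩⟩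

/-- At a skeleton square the shadow line turns and both runs stop, whereas all increasing edges of a
row or column belong to one run. -/
theorem isRook_skeleton (hS : IsRook S) : IsRook (skeleton S) := by
  have key1 : ∀ a b c, (a, b) ∈ skeleton S → (a, c) ∈ skeleton S → ¬ b < c := by
    intro a b c hb hc hlt
    rw [mem_skeleton] at hb hc
    obtain ⟨d, hd, hm, -⟩ := exists_of_rt hb.2
    have h1 : Rt S a (b + 1) := hS.rt_of_rt hm hc.2 (by omega) (by omega)
    have h2 := hS.lis_succ_of_up_rt hb.1 hb.2
    have h3 := hb.1
    unfold Rt at h1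
    unfold Up at h3
    omega
  have key2 : ∀ a b c, (a, c) ∈ skeleton S → (b, c) ∈ skeleton S → ¬ a < b := by
    intro a b c ha hb hlt
    rw [mem_skeleton] at ha hb
    obtain ⟨d, hd, hm, -⟩ := exists_of_up ha.1
    have h1 : Up S (a + 1) c := hS.up_of_up hm hb.1 (by omega) (by omega)
    have h2 := hS.lis_succ_of_up_rt ha.1 ha.2
    have h3 := ha.2
    unfold Up at h1
    unfold Rt at h3
    omega
  exact ⟨fun hb hc => le_antisymm (not_lt.mp (key1 _ _ _ hc hb)) (not_lt.mp (key1 _ _ _ hb hc)),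
    fun hb hc => le_antisymm (not_lt.mp (key2 _ _ _ hc hb)) (not_lt.mp (key2 _ _ _ hb hc))⟩

/-! ### Decreasing chains. -/

/-- `D 0, …, D (k - 1)` are markers going down from left to right. -/
structure DecChain (S : Finset (ℕ × ℕ)) (k : ℕ) (D : ℕ → ℕ × ℕ) : Prop where
  mem : ∀ t < k, D t ∈ S
  col : ∀ t, t + 1 < k → (D t).1 < (D (t + 1)).1
  row : ∀ t, t + 1 < k → (D (t + 1)).2 < (D t).2

namespace DecChain

variable {k : ℕ} {D : ℕ → ℕ × ℕ}

theorem col_lt (h : DecChain S k D) {s t : ℕ} (hst : s < t) (ht : t < k) :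
    (D s).1 < (D t).1 := by
  induction t, hst using Nat.le_induction with
  | base => exact h.col s ht
  | succ t hst ih => exact (ih (by omega)).trans (h.col t ht)

theorem row_lt (h : DecChain S k D) {s t : ℕ} (hst : s < t) (ht : t < k) :
    (D t).2 < (D s).2 := by
  induction t, hst using Nat.le_induction with
  | base => exact h.row s ht
  | succ t hst ih => exact (h.row t ht).trans (ih (by omega))

theorem col_le (h : DecChain S k D) {s t : ℕ} (hst : s ≤ t) (ht : t < k) :
    (D s).1 ≤ (D t).1 := by
  rcases eq_or_lt_of_le hst with rfl | hlt
  · exact le_rfl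
  · exact (h.col_lt hlt ht).le

theorem row_le (h : DecChain S k D) {s t : ℕ} (hst : s ≤ t) (ht : t < k) :
    (D t).2 ≤ (D s).2 := by
  rcases eq_or_lt_of_le hst with rfl | hlt
  · exact le_rfl
  · exact (h.row_lt hlt ht).le

theorem mono {T : Finset (ℕ × ℕ)} (h : DecChain S k D) (hST : ∀ t < k, D t ∈ T) :
    DecChain T k D := ⟨hST, h.col, h.row⟩

theorem of_le (h : DecChain S k D) {l : ℕ} (hl : l ≤ k) : DecChain S l D :=
  ⟨fun t ht => h.mem t (by omega), fun t ht => h.col t (by omega), fun t ht => h.row t (by omega)⟩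

theorem tail (h : DecChain S (k + 1) D) : DecChain S k fun t => D (t + 1) :=
  ⟨fun t ht => h.mem (t + 1) (by omega), fun t ht => h.col (t + 1) (by omega),
    fun t ht => h.row (t + 1) (by omega)⟩

/-- Insert a marker between `D t` and `D (t + 1)`. -/
theorem insert (h : DecChain S k D) {t : ℕ} (ht : t + 1 < k) {m : ℕ × ℕ} (hm : m ∈ S)
    (h1 : (D t).1 < m.1) (h2 : m.1 < (D (t + 1)).1) (h3 : (D (t + 1)).2 < m.2)
    (h4 : m.2 < (D t).2) :
    DecChain S (k + 1) fun s => if s ≤ t then D s else if s = t + 1 then m else D (s - 1) := by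
  have key : ∀ s, s + 1 < k + 1 →
      s + 1 ≤ t ∨ s = t ∨ s = t + 1 ∨ ∃ r, s = r + 1 ∧ t < r ∧ r + 1 < k := by
    intro s hs
    rcases lt_trichotomy s (t + 1) with h | h | h
    · omega
    · omega
    · exact Or.inr (Or.inr (Or.inr ⟨s - 1, by omega, by omega, by omega⟩))
  refine ⟨fun s hs => ?_, fun s hs => ?_, fun s hs => ?_⟩
  · split_ifs
    · exact h.mem s (by omega)
    · exact hm
    · exact h.mem _ (by omega)
  · rcases key s hs with h' | rfl | rfl | ⟨r, rfl, hr, hr'⟩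
    · simpa [h', show s ≤ t by omega] using h.col s (by omega)
    · simpa using h1
    · simpa using h2
    · simpa [show ¬ r + 1 ≤ t by omega, show ¬ r + 1 + 1 ≤ t by omega, show r ≠ t by omega,
        show r + 1 ≠ t by omega] using h.col r hr'
  · rcases key s hs with h' | rfl | rfl | ⟨r, rfl, hr, hr'⟩
    · simpa [h', show s ≤ t by omega] using h.row s (by omega)
    · simpa using h4
    · simpa using h3
    · simpa [show ¬ r + 1 ≤ t by omega, show ¬ r + 1 + 1 ≤ t by omega, show r ≠ t by omega,
        show r + 1 ≠ t by omega] using h.row r hr'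

/-- Replace the marker `D t`. -/
theorem update (h : DecChain S k D) {t : ℕ} {m : ℕ × ℕ} (hm : m ∈ S)
    (h1 : ∀ s, s + 1 = t → (D s).1 < m.1 ∧ m.2 < (D s).2)
    (h2 : t + 1 < k → m.1 < (D (t + 1)).1 ∧ (D (t + 1)).2 < m.2) :
    DecChain S k (Function.update D t m) := by
  refine ⟨fun s hs => ?_, fun s hs => ?_, fun s hs => ?_⟩
  · by_cases hst : s = t
    · subst hst; simpa using hm
    · simpa [hst] using h.mem s hs
  · by_cases hst : s = t
    · subst hst; simpa using (h2 hs).1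
    · by_cases hst' : s + 1 = t
      · subst hst'; simpa using (h1 s rfl).1
      · simpa [hst, hst'] using h.col s hs
  · by_cases hst : s = t
    · subst hst; simpa using (h2 hs).2
    · by_cases hst' : s + 1 = t
      · subst hst'; simpa using (h1 s rfl).2
      · simpa [hst, hst'] using h.row s hs

end DecChain

/-! ### Interlacing of markers and skeleton squares. -/

/-- Southeast of a marker in the same rectangle lies a skeleton square. -/
theorem exists_skeleton_between (hS : IsRook S) {a b c d : ℕ} (hp : (a, b) ∈ S) (hq : (c, d) ∈ S)
    (hac : a < c) (hdb : d < b) :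
    ∃ x y, (x, y) ∈ skeleton S ∧ a < x ∧ x ≤ c ∧ d < y ∧ y ≤ b := by
  -- The horizontal run from `(a, b)` and the vertical run from `(c, d)` head for `(c, b)`. A run
  -- that stops earlier stops at a skeleton square; otherwise `(c, b)` itself is one.
  by_contra! hcon
  have h1 : Up S c b := by
    by_contra h
    obtain ⟨w, hw1, hw2, hw⟩ := exists_up_rt_of_up (by omega) (hS.up_succ hp) h
    have := hcon w b (mem_skeleton.mpr hw) (by omega) (by omega) hdb
    omega
  have h2 : Rt S c b := by
    by_contra h
    obtain ⟨w, hw1, hw2, hw⟩ := exists_up_rt_of_rt (by omega) (hS.rt_succ hq) h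
    have := hcon c w (mem_skeleton.mpr hw) (by omega) (by omega) (by omega)
    omega
  have := hcon c b (mem_skeleton.mpr ⟨h1, h2⟩) hac le_rfl hdb
  omega

/-- The run down from `(a, b)` and the run left from `(c, d)` start at markers. If both markers were
outside the box, the runs would meet in a skeleton square `(a, d)`, a second one in column `a`. -/
theorem exists_mem_between (hS : IsRook S) {a b c d : ℕ} (hp : (a, b) ∈ skeleton S)
    (hq : (c, d) ∈ skeleton S) (hac : a < c) (hdb : d < b) :
    ∃ x y, (x, y) ∈ S ∧ a ≤ x ∧ x < c ∧ d ≤ y ∧ y < b := by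
  have hp' := mem_skeleton.mp hp
  have hq' := mem_skeleton.mp hq
  obtain ⟨y, hy, hym, hyall⟩ := exists_of_rt hp'.2
  obtain ⟨x, hx, hxm, hxall⟩ := exists_of_up hq'.1
  by_cases h1 : a ≤ x
  · exact ⟨x, d, hxm, h1, hx, le_rfl, hdb⟩
  by_cases h2 : d ≤ y
  · exact ⟨a, y, hym, le_rfl, hac, h2, hy⟩
  have h3 : (a, d) ∈ skeleton S :=
    mem_skeleton.mpr ⟨hxall a (by omega) (by omega), hyall d (by omega) (by omega)⟩
  have := (isRook_skeleton hS).col h3 hp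
  omega

/-- Consecutive skeleton squares have a marker between them. The two additional markers start the
horizontal run into `E 0` and the vertical run into `E k`. -/
theorem exists_decChain_of_skeleton (hS : IsRook S) {k : ℕ} {E : ℕ → ℕ × ℕ}
    (hE : DecChain (skeleton S) (k + 1) E) :
    ∃ D, DecChain S (k + 2) D ∧ (∀ t < k + 1, (D t).1 < (E t).1 ∧ (E t).1 ≤ (D (t + 1)).1 ∧
      (D (t + 1)).2 < (E t).2 ∧ (E t).2 ≤ (D t).2) ∧ (D 0).2 = (E 0).2 ∧
      (D (k + 1)).1 = (E k).1 := by
  have key : ∀ t, ∃ p : ℕ × ℕ, t < k + 2 → p ∈ S ∧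
      (t < k + 1 → p.1 < (E t).1 ∧ (E t).2 ≤ p.2) ∧
      (∀ s, s + 1 = t → (E s).1 ≤ p.1 ∧ p.2 < (E s).2) ∧
      (t = 0 → p.2 = (E 0).2) ∧ (t = k + 1 → p.1 = (E k).1) := by
    intro t
    rcases Nat.eq_zero_or_pos t with rfl | ht
    · have h0 : ((E 0).1, (E 0).2) ∈ skeleton S := hE.mem 0 (by omega)
      obtain ⟨x, hx, hxm, -⟩ := exists_of_up (mem_skeleton.mp h0).1
      exact ⟨(x, (E 0).2), fun _ => ⟨hxm, fun _ => ⟨hx, le_rfl⟩, fun s hs => by omega,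
        fun _ => rfl, fun h => by omega⟩⟩
    obtain ⟨t, rfl⟩ : ∃ s, t = s + 1 := ⟨t - 1, by omega⟩
    rcases lt_trichotomy t k with hlt | rfl | hgt
    · have h0 : ((E t).1, (E t).2) ∈ skeleton S := hE.mem t (by omega)
      have h1 : ((E (t + 1)).1, (E (t + 1)).2) ∈ skeleton S := hE.mem _ (by omega)
      obtain ⟨x, y, hm, hx1, hx2, hy1, hy2⟩ := exists_mem_between hS h0 h1 (hE.col t (by omega))
        (hE.row t (by omega))
      refine ⟨(x, y), fun _ => ⟨hm, fun _ => ⟨hx2, hy1⟩, fun s hs => ?_, fun h => by omega,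
        fun h => by omega⟩⟩
      obtain rfl : s = t := by omega
      exact ⟨hx1, hy2⟩
    · have h0 : ((E t).1, (E t).2) ∈ skeleton S := hE.mem t (by omega)
      obtain ⟨y, hy, hym, -⟩ := exists_of_rt (mem_skeleton.mp h0).2
      refine ⟨((E t).1, y), fun _ => ⟨hym, fun h => by omega, fun s hs => ?_, fun h => by omega,
        fun h => rfl⟩⟩
      obtain rfl : s = t := by omega
      exact ⟨le_rfl, hy⟩
    · exact ⟨0, fun h => by omega⟩
  choose D hD using key
  have hbox : ∀ t < k + 1, (D t).1 < (E t).1 ∧ (E t).1 ≤ (D (t + 1)).1 ∧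
      (D (t + 1)).2 < (E t).2 ∧ (E t).2 ≤ (D t).2 := by
    intro t ht
    obtain ⟨-, h1, -⟩ := hD t (by omega)
    obtain ⟨-, -, h2, -⟩ := hD (t + 1) (by omega)
    exact ⟨(h1 ht).1, (h2 t rfl).1, (h2 t rfl).2, (h1 ht).2⟩
  refine ⟨D, ⟨fun t ht => (hD t ht).1, fun t ht => ?_, fun t ht => ?_⟩, hbox,
    (hD 0 (by omega)).2.2.2.1 rfl, (hD (k + 1) (by omega)).2.2.2.2 rfl⟩
  · have := hbox t (by omega); omega
  · have := hbox t (by omega); omega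

/-- Some decreasing sequence of `k` markers lies southwest of the corner `(x, y)`. -/
def HasDecChain (S : Finset (ℕ × ℕ)) (k x y : ℕ) : Prop :=
  ∃ D, DecChain S k D ∧ ∀ t < k, (D t).1 < x ∧ (D t).2 < y

/-- Interlacing in both directions. The extreme row and column of the chain do not grow, so the
bounding corner stays the same. -/
theorem hasDecChain_skeleton (hS : IsRook S) (k x y : ℕ) :
    HasDecChain (skeleton S) (k + 1) x y ↔ HasDecChain S (k + 2) x y := by
  constructor
  · rintro ⟨E, hE, hb⟩
    obtain ⟨D, hD, hbox, h0, h1⟩ := exists_decChain_of_skeleton hS hE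
    refine ⟨D, hD, fun t ht => ⟨?_, ?_⟩⟩
    · rcases Nat.lt_or_ge t (k + 1) with h | h
      · have := hbox t h; have := hb t h; omega
      · obtain rfl : t = k + 1 := by omega
        have := hb k (by omega); omega
    · rcases Nat.eq_zero_or_pos t with rfl | h
      · have := hb 0 (by omega); omega
      · obtain ⟨t, rfl⟩ : ∃ s, t = s + 1 := ⟨t - 1, by omega⟩
        have := hbox t (by omega); have := hb t (by omega); omega
  · rintro ⟨D, hD, hb⟩
    have key : ∀ t, ∃ p : ℕ × ℕ, t < k + 1 → p ∈ skeleton S ∧ (D t).1 < p.1 ∧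
        p.1 ≤ (D (t + 1)).1 ∧ (D (t + 1)).2 < p.2 ∧ p.2 ≤ (D t).2 := by
      intro t
      by_cases ht : t < k + 1
      · obtain ⟨u, v, h⟩ := exists_skeleton_between hS (hD.mem t (by omega))
          (hD.mem (t + 1) (by omega)) (hD.col t (by omega)) (hD.row t (by omega))
        exact ⟨(u, v), fun _ => h⟩
      · exact ⟨0, fun h => absurd h ht⟩
    choose E hE using key
    refine ⟨E, ⟨fun t ht => (hE t ht).1, fun t ht => ?_, fun t ht => ?_⟩, fun t ht => ?_⟩
    · have := hE t (by omega); have := hE (t + 1) ht; omega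
    · have := hE t (by omega); have := hE (t + 1) ht; omega
    · have := hE t ht; have := hb t (by omega); have := hb (t + 1) (by omega); omega

theorem lis_ne_zero_iff (x y : ℕ) : lis S x y ≠ 0 ↔ HasDecChain S 1 x y := by
  constructor
  · intro h
    induction x with
    | zero => simp at h
    | succ x ih =>
      by_cases hr : Rt S x y
      · obtain ⟨b, hb, hm, -⟩ := exists_of_rt hr
        exact ⟨fun _ => (x, b), ⟨fun _ _ => hm, fun t ht => by omega, fun t ht => by omega⟩,
          fun _ _ => ⟨Nat.lt_succ_self x, hb⟩⟩
      · rw [lis_right_eq hr] at h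
        obtain ⟨D, hD, hb⟩ := ih h
        exact ⟨D, hD, fun t ht => ⟨(hb t ht).1.trans (Nat.lt_succ_self x), (hb t ht).2⟩⟩
  · rintro ⟨D, hD, hb⟩
    have h0 := hb 0 one_pos
    have hm : ((D 0).1, (D 0).2) ∈ S := hD.mem 0 one_pos
    have h1 : 0 < lis S ((D 0).1 + 1) ((D 0).2 + 1) := by
      rw [lis_succ, if_pos hm]; omega
    have m1 : ∀ y, Monotone fun x => lis S x y := fun y =>
      monotone_nat_of_le_succ fun x => lis_le_right x y
    have m2 : ∀ x, Monotone fun y => lis S x y := fun x =>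
      monotone_nat_of_le_succ fun y => lis_le_up x y
    have h2 : lis S ((D 0).1 + 1) ((D 0).2 + 1) ≤ lis S x ((D 0).2 + 1) :=
      m1 _ (Nat.succ_le_of_lt h0.1)
    have h3 : lis S x ((D 0).2 + 1) ≤ lis S x y := m2 _ (Nat.succ_le_of_lt h0.2)
    omega

/-! ### Local rules and steps of the growth diagram. -/

/-- `ν` equals `μ` or is obtained from `μ` by adding `1` to one entry. -/
def Step (μ ν : ℕ →₀ ℕ) : Prop := ν = μ ∨ ∃ i, ν = μ + Finsupp.single i 1

theorem single_one_injective {i j : ℕ} (h : Finsupp.single i 1 = (Finsupp.single j 1 : ℕ →₀ ℕ)) :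
    i = j := Finsupp.single_left_injective one_ne_zero h

theorem ruleTwo_add_single (μ : ℕ →₀ ℕ) (i : ℕ) :
    ruleTwo μ (μ + Finsupp.single i 1) = μ + Finsupp.single i 1 + Finsupp.single (i + 1) 1 := by
  have h : ∃ j, μ + Finsupp.single i 1 = μ + Finsupp.single j 1 := ⟨i, rfl⟩
  rw [ruleTwo, dif_pos h, ← single_one_injective (add_left_cancel h.choose_spec)]

theorem sup_add_single {μ : ℕ →₀ ℕ} {i j : ℕ} (h : i ≠ j) :
    (μ + Finsupp.single i 1) ⊔ (μ + Finsupp.single j 1) =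
      μ + Finsupp.single i 1 + Finsupp.single j 1 := by
  ext n
  simp only [Finsupp.sup_apply, Finsupp.add_apply, Finsupp.single_apply]
  split_ifs <;> omega

theorem Step.le {μ ν : ℕ →₀ ℕ} (h : Step μ ν) : μ ≤ ν := by
  rcases h with rfl | ⟨i, rfl⟩
  · exact le_rfl
  · exact le_self_add

theorem add_single_ne (μ : ℕ →₀ ℕ) (i : ℕ) : μ ≠ μ + Finsupp.single i 1 := by
  intro h
  have := DFunLike.congr_fun h i
  simp at this

/-- The possible squares of a growth diagram. -/
theorem northeast_cases {SW NW SE : ℕ →₀ ℕ} (two : (ℕ →₀ ℕ) → (ℕ →₀ ℕ) → (ℕ →₀ ℕ)) (m : Prop)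
    [Decidable m] (hN : Step SW NW) (hE : Step SW SE) :
    (NW = SW ∧ SE = SW ∧
      northeast two m SW NW SE = if m then SW + Finsupp.single 0 1 else SW) ∨
    (NW = SW ∧ (∃ i, SE = SW + Finsupp.single i 1) ∧ northeast two m SW NW SE = SE) ∨
    ((∃ i, NW = SW + Finsupp.single i 1) ∧ SE = SW ∧ northeast two m SW NW SE = NW) ∨
    (∃ i j, i ≠ j ∧ NW = SW + Finsupp.single i 1 ∧ SE = SW + Finsupp.single j 1 ∧
      northeast two m SW NW SE = SW + Finsupp.single i 1 + Finsupp.single j 1) ∨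
    (∃ i, NW = SW + Finsupp.single i 1 ∧ SE = SW + Finsupp.single i 1 ∧
      northeast two m SW NW SE = two SW NW) := by
  rcases hN with rfl | ⟨i, rfl⟩ <;> rcases hE with rfl | ⟨j, rfl⟩
  · left
    simp [northeast]
  · right; left
    refine ⟨rfl, ⟨j, rfl⟩, ?_⟩
    rw [northeast, if_pos (add_single_ne _ _)]
    exact sup_eq_right.mpr le_self_add
  · right; right; left
    refine ⟨⟨i, rfl⟩, rfl, ?_⟩
    rw [northeast, if_pos (add_single_ne _ _).symm]
    exact sup_eq_left.mpr le_self_add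
  · by_cases hij : i = j
    · subst hij
      right; right; right; right
      refine ⟨i, rfl, rfl, ?_⟩
      rw [northeast, if_neg (not_not.mpr rfl), if_pos (add_single_ne _ _)]
    · right; right; right; left
      refine ⟨i, j, hij, rfl, rfl, ?_⟩
      rw [northeast, if_pos, sup_add_single hij]
      exact fun h => hij (single_one_injective (add_left_cancel h))

theorem northeast_step {SW NW SE : ℕ →₀ ℕ} (m : Prop) [Decidable m] (hN : Step SW NW)
    (hE : Step SW SE) : Step NW (northeast ruleTwo m SW NW SE) ∧
      Step SE (northeast ruleTwo m SW NW SE) := by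
  rcases northeast_cases ruleTwo m hN hE with ⟨h1, h2, h⟩ | ⟨h1, h2, h⟩ | ⟨h1, h2, h⟩ |
    ⟨i, j, hij, h1, h2, h⟩ | ⟨i, h1, h2, h⟩ <;> rw [h]
  · subst h1 h2
    split_ifs
    · exact ⟨Or.inr ⟨0, rfl⟩, Or.inr ⟨0, rfl⟩⟩
    · exact ⟨Or.inl rfl, Or.inl rfl⟩
  · subst h1
    exact ⟨Or.inr h2, Or.inl rfl⟩
  · subst h2
    exact ⟨Or.inl rfl, Or.inr h1⟩
  · subst h1 h2
    exact ⟨Or.inr ⟨j, rfl⟩, Or.inr ⟨i, add_right_comm _ _ _⟩⟩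
  · subst h1 h2
    rw [ruleTwo_add_single]
    exact ⟨Or.inr ⟨i + 1, rfl⟩, Or.inr ⟨i + 1, rfl⟩⟩

section corner

variable {two : (ℕ →₀ ℕ) → (ℕ →₀ ℕ) → (ℕ →₀ ℕ)}

@[simp] theorem corner_zero_left (y : ℕ) : corner two S 0 y = 0 := by
  cases y <;> simp [corner]

@[simp] theorem corner_zero_right (x : ℕ) : corner two S x 0 = 0 := by
  cases x <;> simp [corner]

theorem corner_succ (x y : ℕ) : corner two S (x + 1) (y + 1) =
    northeast two ((x, y) ∈ S) (corner two S x y) (corner two S x (y + 1))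
      (corner two S (x + 1) y) := by
  rw [corner]

theorem corner_congr {T : Finset (ℕ × ℕ)} {x y : ℕ}
    (h : ∀ a < x, ∀ b < y, (a, b) ∈ S ↔ (a, b) ∈ T) : corner two S x y = corner two T x y := by
  induction x generalizing y with
  | zero => simp
  | succ x ihx =>
    induction y with
    | zero => simp
    | succ y ihy =>
      rw [corner_succ, corner_succ, ihx fun a ha b hb => h a (by omega) b (by omega),
        ihx fun a ha b hb => h a (by omega) b (by omega),
        ihy fun a ha b hb => h a (by omega) b (by omega)]
      simp only [h x (by omega) y (by omega)]

end corner

/-- Vertical steps along one column, together with the empty bottom edge, give the horizontal steps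
to the next column, and these give its vertical steps. Hence only the squares listed in
`northeast_cases` occur. -/
theorem corner_steps (x : ℕ) : (∀ y, Step (corner ruleTwo S x y) (corner ruleTwo S x (y + 1))) ∧
    ∀ y, Step (corner ruleTwo S x y) (corner ruleTwo S (x + 1) y) := by
  have key : ∀ x, (∀ y, Step (corner ruleTwo S x y) (corner ruleTwo S x (y + 1))) →
      ∀ y, Step (corner ruleTwo S x y) (corner ruleTwo S (x + 1) y) := by
    intro x hx y
    induction y with
    | zero => simp [Step]
    | succ y ih =>
      rw [corner_succ]
      exact (northeast_step _ (hx y) ih).1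
  induction x with
  | zero =>
    have h0 : ∀ y, Step (corner ruleTwo S 0 y) (corner ruleTwo S 0 (y + 1)) := fun y => by
      simp [Step]
    exact ⟨h0, key 0 h0⟩
  | succ x ih =>
    have h1 : ∀ y, Step (corner ruleTwo S (x + 1) y) (corner ruleTwo S (x + 1) (y + 1)) := by
      intro y
      rw [corner_succ]
      exact (northeast_step _ (ih.1 y) (ih.2 y)).2
    exact ⟨h1, key _ h1⟩

theorem step_up (x y : ℕ) : Step (corner ruleTwo S x y) (corner ruleTwo S x (y + 1)) :=
  (corner_steps x).1 y

theorem step_right (x y : ℕ) : Step (corner ruleTwo S x y) (corner ruleTwo S (x + 1) y) :=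
  (corner_steps x).2 y

theorem corner_up_eq {x y : ℕ} (h : ∀ a < x, (a, y) ∉ S) :
    corner ruleTwo S x (y + 1) = corner ruleTwo S x y := by
  induction x with
  | zero => simp
  | succ x ih =>
    have ih' := ih fun a ha => h a (by omega)
    rw [corner_succ]
    rcases northeast_cases ruleTwo ((x, y) ∈ S) (step_up x y) (step_right x y) with
      ⟨-, h2, h3⟩ | ⟨-, -, h3⟩ | ⟨⟨i, hi⟩, -, -⟩ | ⟨i, -, -, hi, -⟩ | ⟨i, hi, -⟩
    · rw [h3, if_neg (h x (by omega)), h2]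
    · exact h3
    all_goals exact absurd (ih'.symm.trans hi) (add_single_ne _ _)

theorem corner_right_eq {x y : ℕ} (h : ∀ b < y, (x, b) ∉ S) :
    corner ruleTwo S (x + 1) y = corner ruleTwo S x y := by
  induction y with
  | zero => simp
  | succ y ih =>
    have ih' := ih fun a ha => h a (by omega)
    rw [corner_succ]
    rcases northeast_cases ruleTwo ((x, y) ∈ S) (step_up x y) (step_right x y) with
      ⟨h2, -, h3⟩ | ⟨-, ⟨i, hi⟩, -⟩ | ⟨-, -, h3⟩ | ⟨-, i, -, -, hi, -⟩ | ⟨i, -, hi, -⟩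
    · rw [h3, if_neg (h y (by omega)), h2]
    · exact absurd (ih'.symm.trans hi) (add_single_ne _ _)
    · exact h3
    all_goals exact absurd (ih'.symm.trans hi) (add_single_ne _ _)

/-- With `IsRook.corner_right_eq`, this shows that a square with a marker always falls under rule 3:
nothing else in its row or column has acted yet. -/
theorem IsRook.corner_up_eq (hS : IsRook S) {x y : ℕ} (h : (x, y) ∈ S) :
    corner ruleTwo S x (y + 1) = corner ruleTwo S x y :=
  GrowthDiagram.corner_up_eq fun _ ha h' => ha.ne (hS.row h' h)

theorem IsRook.corner_right_eq (hS : IsRook S) {x y : ℕ} (h : (x, y) ∈ S) :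
    corner ruleTwo S (x + 1) y = corner ruleTwo S x y :=
  GrowthDiagram.corner_right_eq fun _ ha h' => ha.ne (hS.col h' h)

/-! ### The first entry, and the growth diagram without it. -/

theorem corner_apply_zero (hS : IsRook S) (x y : ℕ) : corner ruleTwo S x y 0 = lis S x y := by
  induction x generalizing y with
  | zero => simp
  | succ x ihx =>
    induction y with
    | zero => simp
    | succ y ihy =>
      rw [lis_succ, ← ihx, ← ihx, ← ihy, corner_succ]
      by_cases hm : (x, y) ∈ S
      · rw [hS.corner_up_eq hm, hS.corner_right_eq hm]
        simp [northeast, hm]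
      · rw [if_neg hm]
        rcases northeast_cases ruleTwo ((x, y) ∈ S) (step_up x y) (step_right x y) with
          ⟨h1, h2, h⟩ | ⟨h1, ⟨i, h2⟩, h⟩ | ⟨⟨i, h1⟩, h2, h⟩ | ⟨i, j, hij, h1, h2, h⟩ | ⟨i, h1, h2, h⟩ <;>
        rw [h]
        · simp [hm, h1, h2]
        · simp [h1, h2]
        · simp [h1, h2]
        · rw [h1, h2]
          simp only [Finsupp.add_apply, Finsupp.single_apply]
          split_ifs <;> omega
        · rw [h1, h2, ruleTwo_add_single]
          simp

/-- A partition without its first entry. -/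
noncomputable def tail (μ : ℕ →₀ ℕ) : ℕ →₀ ℕ :=
  μ.comapDomain Nat.succ Nat.succ_injective.injOn

@[simp] theorem tail_apply (μ : ℕ →₀ ℕ) (n : ℕ) : tail μ n = μ (n + 1) := rfl

@[simp] theorem tail_zero : tail 0 = 0 := by ext n; simp

theorem tail_add_single_zero (μ : ℕ →₀ ℕ) : tail (μ + Finsupp.single 0 1) = tail μ := by
  ext n; simp

theorem tail_add_single_succ (μ : ℕ →₀ ℕ) (i : ℕ) :
    tail (μ + Finsupp.single (i + 1) 1) = tail μ + Finsupp.single i 1 := by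
  ext n; simp [Finsupp.single_apply]

theorem tail_step {μ ν : ℕ →₀ ℕ} (h : Step μ ν) : Step (tail μ) (tail ν) := by
  rcases h with rfl | ⟨i, rfl⟩
  · exact Or.inl rfl
  · cases i with
    | zero => exact Or.inl (tail_add_single_zero μ)
    | succ i => exact Or.inr ⟨i, tail_add_single_succ μ i⟩

/-- Rule 2 acting on the entry with index `0` raises the next one, which after deletion looks like
rule 3 with a marker; this is what `m'` detects. Every other rule is insensitive to a shift of
indices, and an original marker affects only the deleted entry. -/
theorem tail_northeast {SW NW SE : ℕ →₀ ℕ} (m m' : Prop) [Decidable m] [Decidable m']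
    (hN : Step SW NW) (hE : Step SW SE) (hm : m' ↔ NW 0 = SW 0 + 1 ∧ SE 0 = SW 0 + 1) :
    tail (northeast ruleTwo m SW NW SE) =
      northeast ruleTwo m' (tail SW) (tail NW) (tail SE) := by
  rcases northeast_cases ruleTwo m hN hE with ⟨h1, h2, h⟩ | ⟨h1, ⟨i, h2⟩, h⟩ | ⟨⟨i, h1⟩, h2, h⟩ |
    ⟨i, j, hij, h1, h2, h⟩ | ⟨i, h1, h2, h⟩ <;> rw [h]
  · subst h1 h2
    have : ¬ m' := by simp [hm]
    split_ifs <;> simp [northeast, this, tail_add_single_zero]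
  · subst h1
    have : ¬ m' := by simp [hm]
    rcases northeast_cases ruleTwo m' (tail_step hN) (tail_step hE) with ⟨-, h4, h3⟩ | ⟨-, -, h3⟩ |
      ⟨⟨i, h3⟩, -⟩ | ⟨i, j, -, h3, -⟩ | ⟨i, h3, -⟩
    · rw [h3, if_neg this, h4]
    · exact h3.symm
    all_goals exact absurd h3 (add_single_ne _ _)
  · subst h2
    have : ¬ m' := by simp [hm]
    rcases northeast_cases ruleTwo m' (tail_step hN) (tail_step hE) with ⟨h4, -, h3⟩ |
      ⟨-, ⟨i, h3⟩, -⟩ | ⟨-, -, h3⟩ | ⟨i, j, -, -, h3, -⟩ | ⟨i, -, h3, -⟩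
    · rw [h3, if_neg this, h4]
    · exact absurd h3 (add_single_ne _ _)
    · exact h3.symm
    all_goals exact absurd h3 (add_single_ne _ _)
  · have : ¬ m' := by
      rw [hm, h1, h2]
      rintro ⟨h3, h4⟩
      simp only [Finsupp.add_apply, Finsupp.single_apply] at h3 h4
      split_ifs at h3 h4 <;> omega
    have hsup : SW + Finsupp.single i 1 + Finsupp.single j 1 = NW ⊔ SE := by
      rw [h1, h2, sup_add_single hij]
    by_cases ht : tail NW = tail SE
    · have hSW : tail SW = tail NW := by
        rcases i with _ | i
        · rw [h1, tail_add_single_zero]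
        · rcases j with _ | j
          · rw [ht, h2, tail_add_single_zero]
          · rw [h1, h2, tail_add_single_succ, tail_add_single_succ] at ht
            exact absurd (single_one_injective (add_left_cancel ht)) (by omega)
      rw [northeast, if_neg (not_not.mpr ht), if_neg (not_not.mpr hSW), if_neg this, hsup]
      ext n
      have h5 := DFunLike.congr_fun ht n
      have h6 := DFunLike.congr_fun hSW n
      simp only [tail_apply, Finsupp.sup_apply] at h5 h6 ⊢
      omega
    · rw [northeast, if_pos ht, hsup]
      ext n
      simp
  · subst h1 h2
    rw [ruleTwo_add_single]
    cases i with
    | zero =>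
      have : m' := by simp [hm]
      rw [tail_add_single_succ, tail_add_single_zero]
      simp [northeast, this]
    | succ i =>
      rw [tail_add_single_succ, tail_add_single_succ, northeast, if_neg (not_not.mpr rfl),
        if_pos (add_single_ne _ _), ruleTwo_add_single]

theorem tail_corner (hS : IsRook S) (x y : ℕ) :
    tail (corner ruleTwo S x y) = corner ruleTwo (skeleton S) x y := by
  induction x generalizing y with
  | zero => simp
  | succ x ihx =>
    induction y with
    | zero => simp
    | succ y ihy =>
      rw [corner_succ, corner_succ, ← ihx, ← ihx, ← ihy]
      refine tail_northeast _ _ (step_up x y) (step_right x y) ?_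
      rw [mem_skeleton, corner_apply_zero hS, corner_apply_zero hS, corner_apply_zero hS]
      rfl

theorem corner_apply_succ (hS : IsRook S) (x y n : ℕ) :
    corner ruleTwo S x y (n + 1) = corner ruleTwo (skeleton S) x y n := by
  rw [← tail_corner hS, tail_apply]

/-- Peel off first entries: the index drops by one with each passage to the skeleton, and so does
the length of the chain. -/
theorem corner_apply_ne_zero_iff (hS : IsRook S) (x y n : ℕ) :
    corner ruleTwo S x y n ≠ 0 ↔ HasDecChain S (n + 1) x y := by
  induction n generalizing S with
  | zero => rw [corner_apply_zero hS, lis_ne_zero_iff]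
  | succ n ih => rw [corner_apply_succ hS, ih (isRook_skeleton hS), hasDecChain_skeleton hS]

theorem corner_apply_ne_zero_of_le (hS : IsRook S) {x y n l : ℕ} (hl : l ≤ n)
    (h : corner ruleTwo S x y n ≠ 0) : corner ruleTwo S x y l ≠ 0 := by
  rw [corner_apply_ne_zero_iff hS] at h ⊢
  obtain ⟨D, hD, hb⟩ := h
  exact ⟨D, hD.of_le (by omega), fun t ht => hb t (by omega)⟩

/-! ### Where both algorithms agree. -/

theorem card_support_corner_le (hS : IsRook S) {k x y : ℕ}
    (h : corner ruleTwo S x y k = 0) : (corner ruleTwo S x y).support.card ≤ k := by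
  have hsub : (corner ruleTwo S x y).support ⊆ Finset.range k := by
    intro n hn
    rw [Finsupp.mem_support_iff] at hn
    rw [Finset.mem_range]
    by_contra hlt
    exact corner_apply_ne_zero_of_le hS (not_lt.mp hlt) hn h
  simpa using Finset.card_le_card hsub

/-- Entries grow to the north and east, so the entry with index `k` also vanishes everywhere
southwest, and no rule there produces `k + 1` nonzero entries. -/
theorem corner_ruleTwoMod (hS : IsRook S) {k x y : ℕ}
    (h : corner ruleTwo S x y k = 0) :
    corner (ruleTwoMod (k + 1)) S x y = corner ruleTwo S x y := by
  induction x generalizing y with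
  | zero => simp
  | succ x ihx =>
    induction y with
    | zero => simp
    | succ y ihy =>
      have h1 : corner ruleTwo S x (y + 1) k = 0 :=
        Nat.le_zero.mp (((step_right x (y + 1)).le k).trans h.le)
      have h2 : corner ruleTwo S (x + 1) y k = 0 :=
        Nat.le_zero.mp (((step_up (x + 1) y).le k).trans h.le)
      have h3 : corner ruleTwo S x y k = 0 :=
        Nat.le_zero.mp (((step_up x y).le k).trans h1.le)
      have hcard := card_support_corner_le hS h
      rw [corner_succ, ihx h3, ihx h1, ihy h2]
      rw [corner_succ] at hcard ⊢
      unfold northeast at hcard ⊢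
      split_ifs at hcard ⊢ <;> try rfl
      rw [ruleTwoMod, if_neg (by omega)]

/-! ### Least longest chains, pushing and interlaced chains. -/

variable {k : ℕ} {D D' : ℕ → ℕ × ℕ}

/-- `D` is the componentwise least among the longest decreasing sequences of markers. -/
structure LeastChain (S : Finset (ℕ × ℕ)) (k : ℕ) (D : ℕ → ℕ × ℕ) : Prop where
  chain : DecChain S k D
  longest : ∀ E, ¬ DecChain S (k + 1) E
  least : ∀ E, DecChain S k E → ∀ t < k, (D t).1 ≤ (E t).1 ∧ (D t).2 ≤ (E t).2

/-- The markers `D 0, …, D (k - 1)` are replaced by the markers in the column of `D t` and the row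
of `D (t + 1)`. -/
def pushed (S : Finset (ℕ × ℕ)) (k : ℕ) (D : ℕ → ℕ × ℕ) : Finset (ℕ × ℕ) :=
  (S \ (Finset.range k).image D) ∪ (Finset.range (k - 1)).image fun t => ((D t).1, (D (t + 1)).2)

theorem mem_pushed {x y : ℕ} : (x, y) ∈ pushed S k D ↔
    ((x, y) ∈ S ∧ ∀ t < k, ¬ ((D t).1 = x ∧ (D t).2 = y)) ∨
      ∃ t, t + 1 < k ∧ (D t).1 = x ∧ (D (t + 1)).2 = y := by
  simp only [pushed, Finset.mem_union, Finset.mem_sdiff, Finset.mem_image, Finset.mem_range,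
    Prod.ext_iff, not_exists, not_and, Nat.lt_sub_iff_add_lt]

/-- `D' t` is the least skeleton square of the rectangle between `D t` and `D (t + 1)`. -/
structure Interlaced (S : Finset (ℕ × ℕ)) (k : ℕ) (D D' : ℕ → ℕ × ℕ) : Prop where
  mem : ∀ t < k, D' t ∈ skeleton S
  left : ∀ t < k, (D t).1 < (D' t).1
  right : ∀ t < k, (D' t).1 ≤ (D (t + 1)).1
  lower : ∀ t < k, (D (t + 1)).2 < (D' t).2
  upper : ∀ t < k, (D' t).2 ≤ (D t).2
  least : ∀ t < k, ∀ p ∈ skeleton S, (D t).1 < p.1 → p.1 ≤ (D (t + 1)).1 →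
    (D (t + 1)).2 < p.2 → p.2 ≤ (D t).2 → (D' t).1 ≤ p.1 ∧ (D' t).2 ≤ p.2

namespace LeastChain

theorem box_empty (h : LeastChain S k D) {t x y : ℕ} (ht : t + 1 < k) (hm : (x, y) ∈ S)
    (h1 : (D t).1 < x) (h2 : x < (D (t + 1)).1) (h3 : (D (t + 1)).2 < y) (h4 : y < (D t).2) :
    False :=
  h.longest _ (h.chain.insert ht hm h1 h2 h3 h4)

theorem le_of_update (h : LeastChain S k D) {t x y : ℕ} (ht : t < k) (hm : (x, y) ∈ S)
    (h1 : ∀ s, s + 1 = t → (D s).1 < x ∧ y < (D s).2)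
    (h2 : t + 1 < k → x < (D (t + 1)).1 ∧ (D (t + 1)).2 < y) :
    (D t).1 ≤ x ∧ (D t).2 ≤ y := by
  simpa using h.least _ (h.chain.update hm h1 h2) t ht

/-- If the leftmost skeleton square of a box were not also the lowest, `exists_mem_between` would
give a marker strictly inside the box, and the chain could be lengthened. -/
theorem exists_interlaced (hS : IsRook S) (h : LeastChain S (k + 1) D) :
    ∃ D', Interlaced S k D D' := by
  have key : ∀ t, ∃ p : ℕ × ℕ, t < k → p ∈ skeleton S ∧ (D t).1 < p.1 ∧ p.1 ≤ (D (t + 1)).1 ∧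
      (D (t + 1)).2 < p.2 ∧ p.2 ≤ (D t).2 ∧
      ∀ q ∈ skeleton S, (D t).1 < q.1 → q.1 ≤ (D (t + 1)).1 →
        (D (t + 1)).2 < q.2 → q.2 ≤ (D t).2 → p.1 ≤ q.1 ∧ p.2 ≤ q.2 := by
    intro t
    by_cases ht : t < k
    · obtain ⟨u, v, huv, h1, h2, h3, h4⟩ := exists_skeleton_between hS
        (h.chain.mem t (by omega)) (h.chain.mem (t + 1) (by omega)) (h.chain.col t (by omega))
        (h.chain.row t (by omega))
      obtain ⟨p, hp, hmin⟩ := Finset.exists_min_image ((skeleton S).filter fun q =>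
        (D t).1 < q.1 ∧ q.1 ≤ (D (t + 1)).1 ∧ (D (t + 1)).2 < q.2 ∧ q.2 ≤ (D t).2) Prod.fst
        ⟨(u, v), by simp [huv, h1, h2, h3, h4]⟩
      simp only [Finset.mem_filter] at hp hmin
      refine ⟨p, fun _ => ⟨hp.1, hp.2.1, hp.2.2.1, hp.2.2.2.1, hp.2.2.2.2,
        fun q hq h1 h2 h3 h4 => ?_⟩⟩
      have hle := hmin q ⟨hq, h1, h2, h3, h4⟩
      refine ⟨hle, ?_⟩
      by_contra hlt
      have hne : p.1 ≠ q.1 := by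
        intro he
        have := (isRook_skeleton hS).col (a := p.1) (b := p.2) (c := q.2) hp.1 (by rw [he]; exact hq)
        omega
      obtain ⟨x, y, hm, h5, h6, h7, h8⟩ := exists_mem_between hS (a := p.1) (b := p.2) (c := q.1)
        (d := q.2) hp.1 hq (by omega) (by omega)
      exact h.box_empty (t := t) (by omega) hm (by omega) (by omega) (by omega) (by omega)
    · exact ⟨0, fun h => absurd h ht⟩
  choose D' hD' using key
  exact ⟨D', fun t ht => (hD' t ht).1, fun t ht => (hD' t ht).2.1, fun t ht => (hD' t ht).2.2.1,
    fun t ht => (hD' t ht).2.2.2.1, fun t ht => (hD' t ht).2.2.2.2.1,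
    fun t ht => (hD' t ht).2.2.2.2.2⟩

end LeastChain

/-- If one of `D t`, `E t` lay strictly northwest of the other, then the first chain up to `t`
followed by the second from `t` on would be too long. So the two are comparable, and the smaller
ones again form a chain. -/
theorem DecChain.meet (hS : IsRook S) {E : ℕ → ℕ × ℕ} (hD : DecChain S k D)
    (hE : DecChain S k E) (hlong : ∀ E, ¬ DecChain S (k + 1) E) :
    ∃ F, DecChain S k F ∧ ∀ t < k, (F t = D t ∨ F t = E t) ∧ (F t).1 ≤ (D t).1 ∧
      (F t).2 ≤ (D t).2 ∧ (F t).1 ≤ (E t).1 ∧ (F t).2 ≤ (E t).2 := by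
  have append : ∀ A B : ℕ → ℕ × ℕ, DecChain S k A → DecChain S k B → ∀ t < k,
      ¬ ((A t).1 < (B t).1 ∧ (B t).2 < (A t).2) := by
    rintro A B hA hB t ht ⟨h1, h2⟩
    refine hlong (fun s => if s ≤ t then A s else B (s - 1))
      ⟨fun s hs => ?_, fun s hs => ?_, fun s hs => ?_⟩
    · split_ifs
      · exact hA.mem s (by omega)
      · exact hB.mem _ (by omega)
    all_goals
      rcases lt_trichotomy s t with hlt | rfl | hgt
      · simp only [show s ≤ t by omega, show s + 1 ≤ t by omega, if_true]
        first | exact hA.col s (by omega) | exact hA.row s (by omega)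
      · simp [h1, h2]
      · obtain ⟨r, rfl⟩ : ∃ r, s = r + 1 := ⟨s - 1, by omega⟩
        simp only [show ¬ r + 1 ≤ t by omega, show ¬ r + 1 + 1 ≤ t by omega, if_false,
          Nat.add_sub_cancel]
        first | exact hB.col r (by omega) | exact hB.row r (by omega)
  have same : ∀ t < k, (D t).1 = (E t).1 → (D t).2 = (E t).2 := by
    intro t ht he
    have h1 : ((D t).1, (D t).2) ∈ S := hD.mem t ht
    have h2 : ((E t).1, (E t).2) ∈ S := hE.mem t ht
    rw [← he] at h2
    exact hS.col h1 h2
  have comparable : ∀ t < k, ((D t).1 ≤ (E t).1 ∧ (D t).2 ≤ (E t).2) ∨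
      ((E t).1 ≤ (D t).1 ∧ (E t).2 ≤ (D t).2) := by
    intro t ht
    have h1 := append D E hD hE t ht
    have h2 := append E D hE hD t ht
    have hDm : ((D t).1, (D t).2) ∈ S := hD.mem t ht
    have hEm : ((E t).1, (E t).2) ∈ S := hE.mem t ht
    have h3 := same t ht
    have h4 : (D t).2 = (E t).2 → (D t).1 = (E t).1 := by
      intro he
      rw [← he] at hEm
      exact hS.row hDm hEm
    omega
  refine ⟨fun t => if (D t).1 ≤ (E t).1 then D t else E t,
    ⟨fun t ht => ?_, fun t ht => ?_, fun t ht => ?_⟩, fun t ht => ?_⟩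
  · split_ifs
    · exact hD.mem t ht
    · exact hE.mem t ht
  · have := hD.col t ht
    have := hE.col t ht
    split_ifs <;> omega
  · have := hD.row t ht
    have := hE.row t ht
    have := comparable t (by omega)
    have := comparable (t + 1) ht
    have := same t (by omega)
    have := same (t + 1) ht
    split_ifs <;> omega
  · have := comparable t ht
    have := same t ht
    dsimp only
    split_ifs with hc
    · exact ⟨Or.inl rfl, by omega⟩
    · exact ⟨Or.inr rfl, by omega⟩

/-! ### The shape of the boxes between consecutive chain markers. -/

namespace Interlaced

theorem mem' (hI : Interlaced S k D D') {t : ℕ} (ht : t < k) :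
    ((D' t).1, (D' t).2) ∈ skeleton S := hI.mem t ht

/-- The vertical run into `D' t` starts at a marker. As the interior of the box is empty, this
marker is `D (t + 1)` or lies below its row. -/
theorem rt_box (hS : IsRook S) (h : LeastChain S (k + 1) D) (hI : Interlaced S k D D')
    {t y : ℕ} (ht : t < k) (h1 : (D (t + 1)).2 < y) (h2 : y ≤ (D' t).2) : Rt S (D' t).1 y := by
  have hr := (mem_skeleton.mp (hI.mem' ht)).2
  obtain ⟨d, hd, hm, hall⟩ := exists_of_rt hr
  refine hall y ?_ h2
  by_contra hlt
  have := hI.right t ht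
  have := hI.left t ht
  have := hI.upper t ht
  by_cases hb : (D' t).1 = (D (t + 1)).1
  · rw [hb] at hm
    have := hS.col hm (h.chain.mem (t + 1) (by omega))
    omega
  · exact h.box_empty (t := t) (by omega) hm (by omega) (by omega) (by omega) (by omega)

theorem up_box (hS : IsRook S) (h : LeastChain S (k + 1) D) (hI : Interlaced S k D D')
    {t x : ℕ} (ht : t < k) (h1 : (D t).1 < x) (h2 : x ≤ (D' t).1) : Up S x (D' t).2 := by
  have hr := (mem_skeleton.mp (hI.mem' ht)).1
  obtain ⟨d, hd, hm, hall⟩ := exists_of_up hr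
  refine hall x ?_ h2
  by_contra hlt
  have := hI.right t ht
  have := hI.lower t ht
  have := hI.upper t ht
  by_cases hb : (D' t).2 = (D t).2
  · rw [hb] at hm
    have := hS.row hm (h.chain.mem t (by omega))
    omega
  · exact h.box_empty (t := t) (by omega) hm (by omega) (by omega) (by omega) (by omega)

/-- An increasing edge here would start or continue a run that ends at a skeleton square of the box
or meets the horizontal run into `D' t`, giving a skeleton square left of `D' t`. Together with
`not_up_box`, this makes `lis` constant on the part of the box southwest of `D' t`. -/
theorem not_rt_box (hS : IsRook S) (h : LeastChain S (k + 1) D) (hI : Interlaced S k D D')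
    {t x y : ℕ} (ht : t < k) (h1 : (D t).1 ≤ x) (h2 : x < (D' t).1) (h3 : (D (t + 1)).2 ≤ y)
    (h4 : y ≤ (D' t).2) : ¬ Rt S x y := by
  intro hr
  have e1 := hI.right t ht
  have e2 := hI.lower t ht
  have e3 := hI.upper t ht
  rcases eq_or_lt_of_le h1 with rfl | h1
  · exact hS.not_rt (h.chain.mem t (by omega)) (by omega) hr
  have hnot : ¬ Rt S x (D' t).2 := fun hr' => by
    have := hI.least t ht (x, (D' t).2)
      (mem_skeleton.mpr ⟨hI.up_box hS h ht h1 h2.le, hr'⟩) h1 (by dsimp only; omega) e2 e3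
    dsimp only at this
    omega
  obtain ⟨w, h5, h6, h7⟩ := exists_up_rt_of_rt h4 hr hnot
  rcases eq_or_lt_of_le (h3.trans h5) with rfl | h8
  · exact hS.not_up (h.chain.mem (t + 1) (by omega)) (by omega) h7.1
  · have := hI.least t ht (x, w) (mem_skeleton.mpr h7) h1 (by dsimp only; omega) h8
      (by dsimp only; omega)
    dsimp only at this
    omega

theorem not_up_box (hS : IsRook S) (h : LeastChain S (k + 1) D) (hI : Interlaced S k D D')
    {t x y : ℕ} (ht : t < k) (h1 : (D t).1 ≤ x) (h2 : x ≤ (D' t).1) (h3 : (D (t + 1)).2 ≤ y)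
    (h4 : y < (D' t).2) : ¬ Up S x y := by
  intro hr
  have e1 := hI.right t ht
  have e2 := hI.left t ht
  have e3 := hI.upper t ht
  rcases eq_or_lt_of_le h3 with rfl | h3
  · exact hS.not_up (h.chain.mem (t + 1) (by omega)) (by omega) hr
  have hnot : ¬ Up S (D' t).1 y := fun hr' => by
    have := hI.least t ht ((D' t).1, y)
      (mem_skeleton.mpr ⟨hr', hI.rt_box hS h ht h3 h4.le⟩) e2 e1 h3 (by dsimp only; omega)
    dsimp only at this
    omega
  obtain ⟨w, h5, h6, h7⟩ := exists_up_rt_of_up h2 hr hnot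
  rcases eq_or_lt_of_le (h1.trans h5) with rfl | h8
  · exact hS.not_rt (h.chain.mem t (by omega)) (by omega) h7.2
  · have := hI.least t ht (w, y) (mem_skeleton.mpr h7) h8 (by dsimp only; omega) h3
      (by dsimp only; omega)
    dsimp only at this
    omega

/-- The left neighbour in the row of `D' t`, if it is not `D t`. -/
theorem exists_left (hS : IsRook S) (h : LeastChain S (k + 1) D) (hI : Interlaced S k D D')
    {t : ℕ} (ht : t < k) (hlt : (D' t).2 < (D t).2) :
    ∃ s c, s + 1 = t ∧ (c, (D' t).2) ∈ S ∧ c ≤ (D s).1 ∧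
      ∀ x, c < x → x ≤ (D' t).1 → Up S x (D' t).2 := by
  obtain ⟨c, hc, hm, hall⟩ := exists_of_up (mem_skeleton.mp (hI.mem' ht)).1
  have e1 := hI.right t ht
  have e2 := hI.lower t ht
  have h1 : c < (D t).1 := by
    by_contra hge
    rcases eq_or_lt_of_le (not_lt.mp hge) with rfl | hgt
    · have := hS.col hm (h.chain.mem t (by omega))
      omega
    · exact h.box_empty (t := t) (by omega) hm hgt (by omega) e2 hlt
  by_contra! hcon
  -- Unless `(c, (D' t).2)` is blocked by the preceding marker of the chain, it could replace `D t`,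
  -- although it lies further left.
  have := h.le_of_update (t := t) (by omega) hm (fun s hs => ?_) (fun _ => ⟨by omega, e2⟩)
  · omega
  · have h2 : ¬ c ≤ (D s).1 := fun hle => by
      obtain ⟨x, hx1, hx2, hx⟩ := hcon s c hs hm hle
      exact hx (hall x hx1 hx2)
    have := h.chain.row s (by omega)
    subst hs
    omega

/-- The lower neighbour in the column of `D' t`, if it is not `D (t + 1)`. -/
theorem exists_below (hS : IsRook S) (h : LeastChain S (k + 1) D) (hI : Interlaced S k D D')
    {t : ℕ} (ht : t < k) (hlt : (D' t).1 < (D (t + 1)).1) :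
    t + 1 < k ∧ ∃ d, ((D' t).1, d) ∈ S ∧ d ≤ (D (t + 2)).2 ∧
      ∀ y, d < y → y ≤ (D' t).2 → Rt S (D' t).1 y := by
  obtain ⟨d, hd, hm, hall⟩ := exists_of_rt (mem_skeleton.mp (hI.mem' ht)).2
  have e1 := hI.left t ht
  have e2 := hI.upper t ht
  have h1 : d < (D (t + 1)).2 := by
    by_contra hge
    rcases eq_or_lt_of_le (not_lt.mp hge) with he | hgt
    · rw [← he] at hm
      have := hS.row hm (h.chain.mem (t + 1) (by omega))
      omega
    · exact h.box_empty (t := t) (by omega) hm e1 hlt hgt (by omega)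
  by_contra! hcon
  have := h.le_of_update (t := t + 1) (by omega) hm (fun s hs => ?_) (fun h3 => ?_)
  · omega
  · obtain rfl : s = t := by omega
    exact ⟨e1, by omega⟩
  · have h2 : ¬ d ≤ (D (t + 2)).2 := fun hle => by
      obtain ⟨x, hx1, hx2, hx⟩ := hcon (by omega) d hm hle
      exact hx (hall x hx1 hx2)
    have := h.chain.col (t + 1) h3
    show _ ∧ (D (t + 2)).2 < _
    change _ < (D (t + 2)).1 at this
    constructor
    · show _ < (D (t + 2)).1
      omega
    · omega

theorem up_left (hS : IsRook S) (h : LeastChain S (k + 1) D) (hI : Interlaced S k D D')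
    {t : ℕ} (ht : t < k) (hlt : (D' t).2 < (D t).2) : Up S (D t).1 (D' t).2 := by
  obtain ⟨s, c, rfl, -, hc, hall⟩ := hI.exists_left hS h ht hlt
  have := h.chain.col s (by omega)
  have := hI.left _ ht
  exact hall _ (by omega) (by omega)

theorem rt_below (hS : IsRook S) (h : LeastChain S (k + 1) D) (hI : Interlaced S k D D')
    {t : ℕ} (ht : t < k) (hlt : (D' t).1 < (D (t + 1)).1) : Rt S (D' t).1 (D (t + 1)).2 := by
  obtain ⟨ht', d, -, hd, hall⟩ := hI.exists_below hS h ht hlt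
  have : (D (t + 2)).2 < (D (t + 1)).2 := h.chain.row (t + 1) (by omega)
  have := hI.lower _ ht
  exact hall _ (by omega) (by omega)

/-- If both failed, the run leftwards from `D' (t + 1)` would cross the run downwards from `D' t` in
a second skeleton square in the column of `D' t`. -/
theorem alternative (hS : IsRook S) (h : LeastChain S (k + 1) D) (hI : Interlaced S k D D')
    {t : ℕ} (ht : t + 1 < k) : (D' t).1 = (D (t + 1)).1 ∨ (D' (t + 1)).2 = (D (t + 1)).2 := by
  by_contra! hcon
  have e1 := hI.right t (by omega)
  have e2 := hI.upper (t + 1) ht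
  have e3 := hI.left t (by omega)
  have e4 := hI.left (t + 1) ht
  have e5 := hI.lower t (by omega)
  have e6 : (D (t + 2)).2 < _ := hI.lower (t + 1) ht
  obtain ⟨s, c, hs, -, hc, hall⟩ := hI.exists_left hS h ht (by omega)
  obtain ⟨-, d, -, hd, hall'⟩ := hI.exists_below hS h (t := t) (by omega) (by omega)
  obtain rfl : s = t := by omega
  have hsk : ((D' s).1, (D' (s + 1)).2) ∈ skeleton S :=
    mem_skeleton.mpr ⟨hall _ (by omega) (by omega), hall' _ (by omega) (by omega)⟩
  have := (isRook_skeleton hS).col hsk (hI.mem' (by omega))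
  omega

/-- There is no preceding marker to block the exchange in `exists_left`. With `last`, this makes the
skeleton chain end in the same upper row and right column, so the induction stays on the same
rectangle. -/
theorem first (hS : IsRook S) (h : LeastChain S (k + 1) D) (hI : Interlaced S k D D')
    (hk : 0 < k) : (D' 0).2 = (D 0).2 := by
  by_contra hne
  have := hI.upper 0 hk
  obtain ⟨s, c, hs, -⟩ := hI.exists_left hS h hk (by omega)
  omega

theorem last (hS : IsRook S) (h : LeastChain S (k + 2) D) (hI : Interlaced S (k + 1) D D') :
    (D' k).1 = (D (k + 1)).1 := by
  by_contra hne
  have := hI.right k (by omega)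
  have := (hI.exists_below hS h (t := k) (by omega) (by omega)).1
  omega

theorem decChain (hI : Interlaced S k D D') :
    DecChain (skeleton S) k D' := by
  refine ⟨hI.mem, fun t ht => ?_, fun t ht => ?_⟩
  · have := hI.right t (by omega)
    have := hI.left (t + 1) ht
    omega
  · have := hI.lower t (by omega)
    have := hI.upper (t + 1) ht
    omega

/-- A smaller skeleton chain interlaces with a marker chain, which is bounded below by `D`. This
places its squares in the boxes defining `D'`, where `D'` is least. -/
theorem leastChain (hS : IsRook S) (h : LeastChain S (k + 2) D)
    (hI : Interlaced S (k + 1) D D') : LeastChain (skeleton S) (k + 1) D' := by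
  have hlong : ∀ E, ¬ DecChain (skeleton S) (k + 1 + 1) E := fun E hE => by
    obtain ⟨A, hA, -⟩ := exists_decChain_of_skeleton hS hE
    exact h.longest A hA
  refine ⟨hI.decChain, hlong, fun E hE t ht => ?_⟩
  obtain ⟨F, hF, hFE⟩ := (hI.decChain).meet (isRook_skeleton hS) hE hlong
  obtain ⟨h0, h1, h2, h3, h4⟩ := hFE t ht
  suffices hFD : (D' t).1 ≤ (F t).1 ∧ (D' t).2 ≤ (F t).2 by omega
  by_contra hcon
  have e1 := hI.right t ht
  have e2 := hI.upper t ht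
  have h5 : (F t).1 < (D' t).1 ∧ (F t).2 < (D' t).2 := by
    have hm1 : ((F t).1, (F t).2) ∈ skeleton S := hF.mem t ht
    have hm2 := hI.mem' ht
    by_contra hc
    have : (F t).1 = (D' t).1 ∨ (F t).2 = (D' t).2 := by omega
    rcases this with he | he
    · rw [he] at hm1
      have := (isRook_skeleton hS).col hm1 hm2
      omega
    · rw [he] at hm1
      have := (isRook_skeleton hS).row hm1 hm2
      omega
  obtain ⟨A, hA, hbox, -⟩ := exists_decChain_of_skeleton hS hF
  have hb := hbox t ht
  have l1 := h.least A hA t (by omega)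
  have l2 := h.least A hA (t + 1) (by omega)
  have := hI.least t ht (F t) (hF.mem t ht) (by omega) (by omega) (by omega) (by omega)
  omega

end Interlaced

/-! ### The effect of pushing on `lis`. -/

/-- The corners where pushing the markers `D` increases `lis`. -/
def Raised (k : ℕ) (D D' : ℕ → ℕ × ℕ) (x y : ℕ) : Prop :=
  ∃ t < k, (D t).1 < x ∧ x ≤ (D' t).1 ∧ (D (t + 1)).2 < y ∧ y ≤ (D' t).2

theorem exists_column_cases (k : ℕ) (D : ℕ → ℕ × ℕ) (x : ℕ) :
    (x < (D 0).1 ∨ (D k).1 < x) ∨ (∃ t ≤ k, x = (D t).1) ∨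
      ∃ t < k, (D t).1 < x ∧ x < (D (t + 1)).1 := by
  rcases Nat.lt_or_ge x (D 0).1 with h0 | h0
  · exact Or.inl (Or.inl h0)
  have key : ∀ n ≤ k, (D n).1 < x ∨ (∃ t ≤ k, x = (D t).1) ∨
      ∃ t < k, (D t).1 < x ∧ x < (D (t + 1)).1 := by
    intro n hn
    induction n with
    | zero =>
      rcases eq_or_lt_of_le h0 with h1 | h1
      · exact Or.inr (Or.inl ⟨0, hn, h1.symm⟩)
      · exact Or.inl h1
    | succ n ih =>
      rcases ih (by omega) with h1 | h1
      · rcases lt_trichotomy x (D (n + 1)).1 with h2 | h2 | h2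
        · exact Or.inr (Or.inr ⟨n, by omega, h1, h2⟩)
        · exact Or.inr (Or.inl ⟨n + 1, hn, h2⟩)
        · exact Or.inl h2
      · exact Or.inr h1
  rcases key k le_rfl with h1 | h1
  · exact Or.inl (Or.inr h1)
  · exact Or.inr h1

namespace Interlaced

theorem index_eq (h : DecChain S (k + 1) D) {s t x : ℕ} (hs : s < k) (ht : t < k)
    (h1 : (D s).1 < x) (h2 : x ≤ (D (s + 1)).1) (h3 : (D t).1 < x) (h4 : x ≤ (D (t + 1)).1) :
    s = t := by
  rcases lt_trichotomy s t with hlt | he | hlt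
  · have := h.col_le (s := s + 1) (t := t) hlt (by omega)
    omega
  · exact he
  · have := h.col_le (s := t + 1) (t := s) hlt (by omega)
    omega

theorem raised_iff (h : DecChain S (k + 1) D) (hI : Interlaced S k D D') {t x y : ℕ} (ht : t < k)
    (h1 : (D t).1 < x) (h2 : x ≤ (D (t + 1)).1) :
    Raised k D D' x y ↔ x ≤ (D' t).1 ∧ (D (t + 1)).2 < y ∧ y ≤ (D' t).2 := by
  constructor
  · rintro ⟨s, hs, h3, h4, h5⟩
    obtain rfl := index_eq h hs ht h3 (h4.trans (hI.right s hs)) h1 h2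
    exact ⟨h4, h5⟩
  · rintro ⟨h3, h4⟩
    exact ⟨t, ht, h1, h3, h4⟩

theorem not_raised (h : DecChain S (k + 1) D) (hI : Interlaced S k D D') {x y : ℕ}
    (hx : x ≤ (D 0).1 ∨ (D k).1 < x) : ¬ Raised k D D' x y := by
  rintro ⟨t, ht, h1, h2, -⟩
  have h3 := h.col_le (Nat.zero_le t) (by omega)
  have h4 := h.col_le (s := t + 1) (t := k) ht (by omega)
  have := hI.right t ht
  omega

theorem raised_right (h : DecChain S (k + 1) D) (hI : Interlaced S k D D') {t y : ℕ}
    (ht : t ≤ k) :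
    Raised k D D' ((D t).1 + 1) y ↔ t < k ∧ (D (t + 1)).2 < y ∧ y ≤ (D' t).2 := by
  rcases eq_or_lt_of_le ht with rfl | ht
  · simp [hI.not_raised h (Or.inr (Nat.lt_succ_self _))]
  · have h1 := h.col t (by omega)
    rw [hI.raised_iff h ht (Nat.lt_succ_self _) h1]
    have := hI.left t ht
    simp only [ht, true_and, and_iff_right_iff_imp]
    omega

/-- The column of a marker of `D` meets the part of `Raised` on its left, or it does not. -/
theorem raised_left (hS : IsRook S) (h : LeastChain S (k + 2) D) (hI : Interlaced S (k + 1) D D')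
    {t : ℕ} (ht : t ≤ k + 1) :
    (((∀ s, s + 1 = t → (D' s).1 < (D t).1) ∧ t < k + 1 ∧ (D' t).2 = (D t).2) ∧
      ∀ y, ¬ Raised (k + 1) D D' (D t).1 y) ∨
    ∃ s, s + 1 = t ∧ (D' s).1 = (D t).1 ∧
      ∀ y, Raised (k + 1) D D' (D t).1 y ↔ (D t).2 < y ∧ y ≤ (D' s).2 := by
  rcases Nat.eq_zero_or_pos t with rfl | h0
  · exact Or.inl ⟨⟨fun s hs => by omega, by omega, hI.first hS h (by omega)⟩,
      fun y => hI.not_raised h.chain (Or.inl le_rfl)⟩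
  obtain ⟨s, rfl⟩ : ∃ s, t = s + 1 := ⟨t - 1, by omega⟩
  have h1 := hI.right s (by omega)
  have h2 := h.chain.col s (by omega)
  have hiff := fun y => hI.raised_iff h.chain (y := y) (show s < k + 1 by omega) h2 le_rfl
  by_cases he : (D' s).1 = (D (s + 1)).1
  · refine Or.inr ⟨s, rfl, he, fun y => ?_⟩
    rw [hiff, he]
    simp
  · refine Or.inl ⟨⟨fun r hr => ?_, ?_⟩, fun y => ?_⟩
    · obtain rfl : r = s := by omega
      omega
    · have hs : s < k := by
        by_contra hs
        obtain rfl : s = k := by omega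
        exact he (hI.last hS h)
      exact ⟨by omega, (hI.alternative hS h (by omega)).resolve_left he⟩
    · rw [hiff]
      omega

end Interlaced

theorem mem_pushed_col (hS : IsRook S) (h : DecChain S (k + 1) D) {t y : ℕ} (ht : t ≤ k) :
    ((D t).1, y) ∈ pushed S (k + 1) D ↔ t < k ∧ y = (D (t + 1)).2 := by
  have hinj : ∀ s ≤ k, (D s).1 = (D t).1 → s = t := by
    intro s hs he
    rcases lt_trichotomy s t with hlt | he' | hlt
    · have := h.col_lt hlt (by omega); omega
    · exact he'
    · have := h.col_lt hlt (by omega); omega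
  rw [mem_pushed]
  constructor
  · rintro (⟨h1, h2⟩ | ⟨s, h1, h2, h3⟩)
    · exact absurd ⟨rfl, hS.col (h.mem t (by omega)) h1⟩ (h2 t (by omega))
    · obtain rfl := hinj s (by omega) h2
      exact ⟨by omega, h3.symm⟩
  · rintro ⟨h1, rfl⟩
    exact Or.inr ⟨t, by omega, rfl, rfl⟩

theorem mem_pushed_of_ne {x y : ℕ} (hx : ∀ t < k, (D t).1 ≠ x) :
    (x, y) ∈ pushed S k D ↔ (x, y) ∈ S := by
  rw [mem_pushed]
  constructor
  · rintro (⟨h1, -⟩ | ⟨s, h1, h2, -⟩)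
    · exact h1
    · exact absurd h2 (hx s (by omega))
  · exact fun h => Or.inl ⟨h, fun t ht h' => hx t ht h'.1⟩

theorem DecChain.ne_of_between (h : DecChain S (k + 1) D) {t x : ℕ} (ht : t < k)
    (h1 : (D t).1 < x) (h2 : x < (D (t + 1)).1) : ∀ s < k + 1, (D s).1 ≠ x := by
  intro s hs he
  rcases Nat.lt_or_ge t s with h3 | h3
  · have := h.col_le (s := t + 1) (t := s) h3 (by omega)
    omega
  · have := h.col_le h3 (by omega)
    omega

theorem DecChain.ne_of_outside (h : DecChain S (k + 1) D) {x : ℕ}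
    (hx : x < (D 0).1 ∨ (D k).1 < x) : ∀ s < k + 1, (D s).1 ≠ x := by
  intro s hs he
  have h3 := h.col_le (Nat.zero_le s) (by omega)
  have h4 := h.col_le (Nat.le_of_lt_succ hs) (by omega)
  omega

-- The new marker in this column starts the raised box on its right. The loss of `D t` is made up by
-- that box when it reaches up to the row of `D t`, and otherwise by the raised box on the left,
-- which begins just above that row.
open Classical in
theorem lis_add_raised_column (hS : IsRook S) (h : LeastChain S (k + 2) D)
    (hI : Interlaced S (k + 1) D D') {t : ℕ} (ht : t ≤ k + 1) (y : ℕ) :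
    lis S ((D t).1 + 1) (y + 1) + (if Raised (k + 1) D D' ((D t).1 + 1) (y + 1) then 1 else 0) =
      max (max (lis S (D t).1 (y + 1) + if Raised (k + 1) D D' (D t).1 (y + 1) then 1 else 0)
        (lis S ((D t).1 + 1) y + if Raised (k + 1) D D' ((D t).1 + 1) y then 1 else 0))
      (lis S (D t).1 y + (if Raised (k + 1) D D' (D t).1 y then 1 else 0) +
        if ((D t).1, y) ∈ pushed S (k + 2) D then 1 else 0) := by
  have a1 := lis_succ (S := S) (D t).1 y
  have b1 := lis_le_right (S := S) (D t).1 y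
  have b2 := lis_right_le (S := S) (D t).1 y
  have b3 := lis_le_up (S := S) (D t).1 y
  have b4 := lis_up_le (S := S) (D t).1 y
  have hm : ((D t).1, (D t).2) ∈ S := h.chain.mem t (by omega)
  have c1 : y < (D t).2 → (((D t).1, y) ∉ S) := fun hy hmem => by
    have := hS.col hm hmem; omega
  have c2 : (D t).2 < y → (((D t).1, y) ∉ S) := fun hy hmem => by
    have := hS.col hm hmem; omega
  simp only [mem_pushed_col hS h.chain (show t ≤ k + 1 by omega),
    hI.raised_right h.chain (show t ≤ k + 1 by omega)]
  have d1 : y ≤ (D t).2 → lis S ((D t).1 + 1) y = lis S (D t).1 y := fun hy =>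
    lis_right_eq (hS.not_rt hm hy)
  have d2 : y + 1 ≤ (D t).2 → lis S ((D t).1 + 1) (y + 1) = lis S (D t).1 (y + 1) :=
    fun hy => lis_right_eq (hS.not_rt hm hy)
  have d3 : y = (D t).2 → lis S (D t).1 (y + 1) = lis S (D t).1 y := fun hy =>
    lis_up_eq (hS.not_up (by rw [hy]; exact hm) le_rfl)
  have e1 : t < k + 1 → (D (t + 1)).2 < (D' t).2 ∧ (D' t).2 ≤ (D t).2 := fun ht =>
    ⟨hI.lower t ht, hI.upper t ht⟩
  have e2 : t < k + 1 → (D (t + 1)).2 ≤ y → y < (D' t).2 →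
      lis S (D t).1 (y + 1) = lis S (D t).1 y := fun ht h3 h4 =>
    lis_up_eq (hI.not_up_box hS h ht le_rfl (hI.left t ht).le h3 h4)
  have e3 : t < k + 1 → (D' t).2 < (D t).2 → y = (D' t).2 →
      lis S (D t).1 (y + 1) = lis S (D t).1 y + 1 := fun ht h3 h4 => by
    rw [h4]; exact hI.up_left hS h ht h3
  rcases hI.raised_left hS h ht with ⟨⟨-, f1, f2⟩, hno⟩ | ⟨s, rfl, f1, hiff⟩
  · simp only [hno, if_false, add_zero]
    rcases lt_trichotomy y (D t).2 with hy | hy | hy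
    · have := c1 hy
      split_ifs at a1 ⊢ <;> omega
    · subst hy
      split_ifs at a1 ⊢ <;> omega
    · have := c2 hy
      split_ifs at a1 ⊢ <;> omega
  · have e4 : (D (s + 1)).2 < y → y ≤ (D' s).2 →
        lis S ((D (s + 1)).1 + 1) y = lis S (D (s + 1)).1 y + 1 := fun h3 h4 => by
      have := hI.rt_box hS h (by omega) h3 h4
      rwa [f1] at this
    have e5 : (D (s + 1)).2 < y + 1 → y + 1 ≤ (D' s).2 →
        lis S ((D (s + 1)).1 + 1) (y + 1) = lis S (D (s + 1)).1 (y + 1) + 1 :=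
      fun h3 h4 => by
        have := hI.rt_box hS h (by omega) h3 h4
        rwa [f1] at this
    have e6 := hI.lower s (by omega)
    simp only [hiff]
    rcases lt_trichotomy y (D (s + 1)).2 with hy | hy | hy
    · have := c1 hy
      split_ifs at a1 ⊢ <;> omega
    · subst hy
      split_ifs at a1 ⊢ <;> omega
    · have := c2 hy
      split_ifs at a1 ⊢ <;> omega


-- No marker of this column moves. The raise stops at the column and row of `D' t` because there
-- `lis` already increases by one across the edges concerned.
open Classical in
theorem lis_add_raised_between (hS : IsRook S) (h : LeastChain S (k + 2) D)
    (hI : Interlaced S (k + 1) D D') {t : ℕ} {x : ℕ} (ht : t < k + 1)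
    (h1 : (D t).1 < x) (h2 : x < (D (t + 1)).1) (y : ℕ) :
    lis S (x + 1) (y + 1) + (if Raised (k + 1) D D' (x + 1) (y + 1) then 1 else 0) =
      max (max (lis S x (y + 1) + if Raised (k + 1) D D' x (y + 1) then 1 else 0)
        (lis S (x + 1) y + if Raised (k + 1) D D' (x + 1) y then 1 else 0))
      (lis S x y + (if Raised (k + 1) D D' x y then 1 else 0) +
        if (x, y) ∈ pushed S (k + 2) D then 1 else 0) := by
  have a1 := lis_succ (S := S) x y
  have b1 := lis_le_right (S := S) x y
  have b2 := lis_right_le (S := S) x y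
  have b3 := lis_le_up (S := S) x y
  have b4 := lis_up_le (S := S) x y
  simp only [mem_pushed_of_ne (h.chain.ne_of_between ht h1 h2),
    hI.raised_iff h.chain ht h1 h2.le, hI.raised_iff h.chain ht (x := x + 1)
      (by omega) (by omega)]
  have d1 : x < (D' t).1 → (D (t + 1)).2 ≤ y → y ≤ (D' t).2 →
      lis S (x + 1) y = lis S x y := fun h3 h4 h5 =>
    lis_right_eq (hI.not_rt_box hS h ht h1.le h3 h4 h5)
  have d2 : x < (D' t).1 → (D (t + 1)).2 ≤ y + 1 → y + 1 ≤ (D' t).2 →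
      lis S (x + 1) (y + 1) = lis S x (y + 1) := fun h3 h4 h5 =>
    lis_right_eq (hI.not_rt_box hS h ht h1.le h3 h4 h5)
  have d3 : x ≤ (D' t).1 → (D (t + 1)).2 ≤ y → y < (D' t).2 →
      lis S x (y + 1) = lis S x y := fun h3 h4 h5 =>
    lis_up_eq (hI.not_up_box hS h ht h1.le h3 h4 h5)
  have e1 : x = (D' t).1 → (D (t + 1)).2 < y → y ≤ (D' t).2 →
      lis S (x + 1) y = lis S x y + 1 := fun h3 h4 h5 => by
    rw [h3]; exact hI.rt_box hS h ht h4 h5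
  have e2 : x = (D' t).1 → (D (t + 1)).2 < y + 1 → y + 1 ≤ (D' t).2 →
      lis S (x + 1) (y + 1) = lis S x (y + 1) + 1 := fun h3 h4 h5 => by
    rw [h3]; exact hI.rt_box hS h ht h4 h5
  have e3 : x ≤ (D' t).1 → y = (D' t).2 → lis S x (y + 1) = lis S x y + 1 :=
    fun h3 h4 => by rw [h4]; exact hI.up_box hS h ht h1 h3
  have e4 : x < (D' t).1 → y = (D' t).2 → lis S (x + 1) (y + 1) = lis S (x + 1) y + 1 :=
    fun h3 h4 => by rw [h4]; exact hI.up_box hS h ht (by omega) h3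
  have e6 := hI.lower t ht
  have m1 : (x, y) ∈ S → lis S (x + 1) y = lis S x y ∧ lis S x (y + 1) = lis S x y :=
    fun hm => ⟨lis_right_eq (hS.not_rt hm le_rfl), lis_up_eq (hS.not_up hm le_rfl)⟩
  by_cases hm : (x, y) ∈ S
  · have := m1 hm
    simp only [hm, if_true] at a1 ⊢
    split_ifs <;> omega
  · simp only [hm, if_false] at a1 ⊢
    split_ifs <;> omega



-- The right side satisfies the recursion defining `lis` for the pushed set; the check differs for
-- columns outside the chain, of the chain, and between its markers.
open Classical in
theorem lis_pushed (hS : IsRook S) (h : LeastChain S (k + 2) D) (hI : Interlaced S (k + 1) D D')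
    (x y : ℕ) : lis (pushed S (k + 2) D) x y =
      lis S x y + if Raised (k + 1) D D' x y then 1 else 0 := by
  induction x generalizing y with
  | zero =>
    have : ¬ Raised (k + 1) D D' 0 y := by rintro ⟨t, -, h1, -⟩; omega
    simp [this]
  | succ x ihx =>
    induction y with
    | zero =>
      have : ¬ Raised (k + 1) D D' (x + 1) 0 := by rintro ⟨t, -, -, -, h1, -⟩; omega
      simp [this]
    | succ y ihy =>
      rw [lis_succ, ihx, ihx, ihy]
      symm
      rcases exists_column_cases (k + 1) D x with hx | ⟨t, ht, rfl⟩ | ⟨t, ht, h1, h2⟩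
      · simp only [hI.not_raised h.chain (x := x) (show _ ∨ _ by omega),
          hI.not_raised h.chain (x := x + 1) (show _ ∨ _ by omega), if_false, add_zero,
          mem_pushed_of_ne (h.chain.ne_of_outside hx)]
        exact lis_succ x y
      · exact lis_add_raised_column hS h hI ht y
      · exact lis_add_raised_between hS h hI ht h1 h2 y

/-! ### The effect of pushing on the skeleton. -/

open Classical in
theorem mem_skeleton_pushed (hS : IsRook S) (h : LeastChain S (k + 2) D)
    (hI : Interlaced S (k + 1) D D') (x y : ℕ) :
    (x, y) ∈ skeleton (pushed S (k + 2) D) ↔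
      lis S x (y + 1) + (if Raised (k + 1) D D' x (y + 1) then 1 else 0) =
        lis S x y + (if Raised (k + 1) D D' x y then 1 else 0) + 1 ∧
      lis S (x + 1) y + (if Raised (k + 1) D D' (x + 1) y then 1 else 0) =
        lis S x y + (if Raised (k + 1) D D' x y then 1 else 0) + 1 := by
  rw [mem_skeleton, Up, Rt, lis_pushed hS h hI, lis_pushed hS h hI, lis_pushed hS h hI]

theorem mem_skeleton_pushed_column (hS : IsRook S) (h : LeastChain S (k + 2) D)
    (hI : Interlaced S (k + 1) D D') {t : ℕ} (ht : t ≤ k + 1) (y : ℕ) :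
    ((D t).1, y) ∈ skeleton (pushed S (k + 2) D) ↔
      ((D t).1, y) ∈ pushed (skeleton S) (k + 1) D' := by
  classical
  rw [mem_skeleton_pushed hS h hI, mem_pushed, mem_skeleton, Up, Rt]
  have hcol : ∀ s < k + 1, (D' s).1 = (D t).1 → s + 1 = t := by
    intro s hs he
    have h1 := hI.left s hs
    have h2 := hI.right s hs
    rcases lt_trichotomy (s + 1) t with h3 | h3 | h3
    · have := h.chain.col_lt h3 (by omega); omega
    · exact h3
    · have := h.chain.col_le (Nat.le_of_lt_succ h3) (by omega); omega
  have hm : ((D t).1, (D t).2) ∈ S := h.chain.mem t (by omega)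
  simp only [hI.raised_right h.chain (show t ≤ k + 1 by omega)]
  have d1 : y ≤ (D t).2 → lis S ((D t).1 + 1) y = lis S (D t).1 y := fun hy =>
    lis_right_eq (hS.not_rt hm hy)
  have d3 : y = (D t).2 → lis S (D t).1 (y + 1) = lis S (D t).1 y := fun hy =>
    lis_up_eq (hS.not_up (by rw [hy]; exact hm) le_rfl)
  have e1 : t < k + 1 → (D (t + 1)).2 < (D' t).2 ∧ (D' t).2 ≤ (D t).2 := fun ht =>
    ⟨hI.lower t ht, hI.upper t ht⟩
  have e2 : t < k + 1 → (D (t + 1)).2 ≤ y → y < (D' t).2 →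
      lis S (D t).1 (y + 1) = lis S (D t).1 y := fun ht h3 h4 =>
    lis_up_eq (hI.not_up_box hS h ht le_rfl (hI.left t ht).le h3 h4)
  have e3 : t < k + 1 → (D' t).2 < (D t).2 → y = (D' t).2 →
      lis S (D t).1 (y + 1) = lis S (D t).1 y + 1 := fun ht h3 h4 => by
    rw [h4]; exact hI.up_left hS h ht h3
  rcases hI.raised_left hS h ht with ⟨⟨f0, f1, f2⟩, hno⟩ | ⟨s, rfl, f1, hiff⟩
  · have hne : ∀ s < k + 1, (D' s).1 ≠ (D t).1 := fun s hs he => by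
      have := f0 s (hcol s hs he); omega
    have g1 : ∀ s < k + 1, ¬ ((D' s).1 = (D t).1 ∧ (D' s).2 = y) := fun s hs he => hne s hs he.1
    have g2 : ¬ ∃ s, s + 1 < k + 1 ∧ (D' s).1 = (D t).1 ∧ (D' (s + 1)).2 = y := by
      rintro ⟨s, hs, he, -⟩
      exact hne s (by omega) he
    simp only [hno, if_false, add_zero, g2, or_false, and_iff_left g1]
    rcases lt_trichotomy y (D t).2 with hy | hy | hy <;> split_ifs <;> omega
  · have g1 : (∀ r < k + 1, ¬ ((D' r).1 = (D (s + 1)).1 ∧ (D' r).2 = y)) ↔ (D' s).2 ≠ y := by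
      constructor
      · exact fun hall he => hall s (by omega) ⟨f1, he⟩
      · rintro hne r hr ⟨h1, h2⟩
        obtain rfl : r = s := by have := hcol r hr h1; omega
        exact hne h2
    have g2 : (∃ r, r + 1 < k + 1 ∧ (D' r).1 = (D (s + 1)).1 ∧ (D' (r + 1)).2 = y) ↔
        s + 1 < k + 1 ∧ (D' (s + 1)).2 = y := by
      constructor
      · rintro ⟨r, hr, h1, h2⟩
        obtain rfl : r = s := by have := hcol r (by omega) h1; omega
        exact ⟨hr, h2⟩
      · rintro ⟨h1, h2⟩
        exact ⟨s, h1, f1, h2⟩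
    rw [g1, g2]
    clear g1 g2
    have e4 : (D (s + 1)).2 < y → y ≤ (D' s).2 →
        lis S ((D (s + 1)).1 + 1) y = lis S (D (s + 1)).1 y + 1 := fun h3 h4 => by
      have := hI.rt_box hS h (by omega) h3 h4
      rwa [f1] at this
    have e5 : (D (s + 1)).2 ≤ y → y < (D' s).2 →
        lis S (D (s + 1)).1 (y + 1) = lis S (D (s + 1)).1 y := fun h3 h4 =>
      lis_up_eq (hI.not_up_box hS h (t := s) (by omega) (h.chain.col s (by omega)).le f1.ge h3 h4)
    have e6 := hI.lower s (by omega)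
    simp only [hiff]
    rcases lt_trichotomy y (D (s + 1)).2 with hy | hy | hy <;> split_ifs <;> omega

theorem mem_skeleton_pushed_between (hS : IsRook S) (h : LeastChain S (k + 2) D)
    (hI : Interlaced S (k + 1) D D') {t x : ℕ} (ht : t < k + 1) (h1 : (D t).1 < x)
    (h2 : x < (D (t + 1)).1) (y : ℕ) :
    (x, y) ∈ skeleton (pushed S (k + 2) D) ↔ (x, y) ∈ pushed (skeleton S) (k + 1) D' := by
  classical
  rw [mem_skeleton_pushed hS h hI, mem_pushed, mem_skeleton, Up, Rt]
  have hcol : ∀ s < k + 1, (D' s).1 = x → s = t := fun s hs he =>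
    Interlaced.index_eq h.chain hs ht (he ▸ hI.left s hs) (he ▸ hI.right s hs) h1 h2.le
  have g1 : (∀ r < k + 1, ¬ ((D' r).1 = x ∧ (D' r).2 = y)) ↔
      ¬ ((D' t).1 = x ∧ (D' t).2 = y) := by
    constructor
    · exact fun hall => hall t ht
    · rintro hne r hr ⟨h3, h4⟩
      obtain rfl := hcol r hr h3
      exact hne ⟨h3, h4⟩
  -- The column `x` lies left of `D (t + 1)`, so by `alternative` the pushed skeleton square in it
  -- has the row of `D (t + 1)`.
  have g2 : (∃ r, r + 1 < k + 1 ∧ (D' r).1 = x ∧ (D' (r + 1)).2 = y) ↔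
      (D' t).1 = x ∧ (D (t + 1)).2 = y := by
    constructor
    · rintro ⟨r, hr, h3, h4⟩
      obtain rfl := hcol r (by omega) h3
      have := hI.alternative hS h hr
      omega
    · rintro ⟨h3, h4⟩
      have h5 : t < k := by
        by_contra hlt
        obtain rfl : t = k := by omega
        have := hI.last hS h
        omega
      have := hI.alternative hS h (t := t) (by omega)
      exact ⟨t, by omega, h3, by omega⟩
  rw [g1, g2]
  simp only [hI.raised_iff h.chain ht h1 h2.le, hI.raised_iff h.chain ht (x := x + 1)
      (by omega) (by omega)]
  have d1 : x < (D' t).1 → (D (t + 1)).2 ≤ y → y ≤ (D' t).2 →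
      lis S (x + 1) y = lis S x y := fun h3 h4 h5 =>
    lis_right_eq (hI.not_rt_box hS h ht h1.le h3 h4 h5)
  have d3 : x ≤ (D' t).1 → (D (t + 1)).2 ≤ y → y < (D' t).2 →
      lis S x (y + 1) = lis S x y := fun h3 h4 h5 =>
    lis_up_eq (hI.not_up_box hS h ht h1.le h3 h4 h5)
  have e1 : x = (D' t).1 → (D (t + 1)).2 < y → y ≤ (D' t).2 →
      lis S (x + 1) y = lis S x y + 1 := fun h3 h4 h5 => by
    rw [h3]; exact hI.rt_box hS h ht h4 h5
  have e2 : x = (D' t).1 → y = (D (t + 1)).2 → lis S (x + 1) y = lis S x y + 1 :=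
    fun h3 h4 => by
      rw [h3, h4]; exact hI.rt_below hS h ht (by omega)
  have e3 : x ≤ (D' t).1 → y = (D' t).2 → lis S x (y + 1) = lis S x y + 1 :=
    fun h3 h4 => by rw [h4]; exact hI.up_box hS h ht h1 h3
  have e6 := hI.lower t ht
  rcases lt_trichotomy x (D' t).1 with hx | hx | hx <;> split_ifs <;> omega

theorem skeleton_pushed (hS : IsRook S) (h : LeastChain S (k + 2) D)
    (hI : Interlaced S (k + 1) D D') :
    skeleton (pushed S (k + 2) D) = pushed (skeleton S) (k + 1) D' := by
  ext ⟨x, y⟩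
  rcases exists_column_cases (k + 1) D x with hx | ⟨t, ht, rfl⟩ | ⟨t, ht, h1, h2⟩
  · rw [mem_pushed_of_ne, mem_skeleton_pushed hS h hI, mem_skeleton]
    · simp only [hI.not_raised h.chain (x := x) (show _ ∨ _ by omega),
        hI.not_raised h.chain (x := x + 1) (show _ ∨ _ by omega), if_false, add_zero]
      rfl
    · intro t ht he
      have := hI.left t ht
      have := hI.right t ht
      have := h.chain.col_le (Nat.zero_le t) (by omega)
      have := h.chain.col_le (s := t + 1) (t := k + 1) (by omega) (by omega)
      omega
  · exact mem_skeleton_pushed_column hS h hI ht y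
  · exact mem_skeleton_pushed_between hS h hI ht h1 h2 y

theorem isRook_pushed (hS : IsRook S) (h : DecChain S k D) : IsRook (pushed S k D) := by
  have hc : ∀ s < k, ∀ t < k, (D s).1 = (D t).1 → s = t := by
    intro s hs t ht he
    rcases lt_trichotomy s t with hlt | he' | hlt
    · have := h.col_lt hlt (by omega); omega
    · exact he'
    · have := h.col_lt hlt (by omega); omega
  have hr : ∀ s < k, ∀ t < k, (D s).2 = (D t).2 → s = t := by
    intro s hs t ht he
    rcases lt_trichotomy s t with hlt | he' | hlt
    · have := h.row_lt hlt (by omega); omega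
    · exact he'
    · have := h.row_lt hlt (by omega); omega
  have hmem : ∀ t < k, ((D t).1, (D t).2) ∈ S := h.mem
  constructor
  · intro a b c hb hb'
    rcases mem_pushed.mp hb with ⟨h1, h2⟩ | ⟨s, hs, rfl, rfl⟩ <;>
    rcases mem_pushed.mp hb' with ⟨h3, h4⟩ | ⟨t, ht, h5, rfl⟩
    · exact hS.col h1 h3
    · subst h5
      exact absurd ⟨rfl, hS.col (hmem t (by omega)) h1⟩ (h2 t (by omega))
    · exact absurd ⟨rfl, hS.col (hmem s (by omega)) h3⟩ (h4 s (by omega))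
    · rw [hc t (by omega) s (by omega) h5]
  · intro a b c hb hb'
    rcases mem_pushed.mp hb with ⟨h1, h2⟩ | ⟨s, hs, rfl, rfl⟩ <;>
    rcases mem_pushed.mp hb' with ⟨h3, h4⟩ | ⟨t, ht, rfl, h5⟩
    · exact hS.row h1 h3
    · subst h5
      exact absurd ⟨hS.row (hmem _ ht) h1, rfl⟩ (h2 _ ht)
    · exact absurd ⟨hS.row (hmem _ hs) h3, rfl⟩ (h4 _ hs)
    · have := hr _ ht _ hs h5
      rw [Nat.succ_injective this]

/-! ### Passing around the rectangle of an occurrence. -/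

/-- Pushing the least longest decreasing sequence does not change the partitions along the right
and upper sides of the rectangle that it spans. -/
theorem corner_pushed (hS : IsRook S) (h : LeastChain S (k + 1) D) {x y : ℕ}
    (hxy : x ≤ (D k).1 ∧ y = (D 0).2 + 1 ∨ x = (D k).1 + 1 ∧ y ≤ (D 0).2) :
    corner ruleTwo (pushed S (k + 1) D) x y = corner ruleTwo S x y := by
  induction k generalizing S D with
  | zero =>
    -- Pushing a single marker deletes it, and it is not southwest of any of the corners considered.
    refine corner_congr fun a ha b hb => ?_
    rw [mem_pushed]
    constructor
    · rintro (h1 | ⟨t, ht, -⟩)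
      · exact h1.1
      · omega
    · refine fun h1 => Or.inl ⟨h1, ?_⟩
      rintro t ht ⟨rfl, rfl⟩
      obtain rfl : t = 0 := by omega
      omega
  | succ k ih =>
    obtain ⟨D', hI⟩ := h.exists_interlaced hS
    have h0 := hI.first hS h (by omega)
    have h1 := hI.last hS h
    ext n
    cases n with
    | zero =>
      classical
      rw [corner_apply_zero (isRook_pushed hS h.chain), corner_apply_zero hS,
        lis_pushed hS h hI, if_neg, add_zero]
      rintro ⟨t, ht, h3, h4, h5, h6⟩
      have := hI.right t ht
      have := hI.upper t ht
      have := h.chain.col_le (s := t + 1) (t := k + 1) (by omega) (by omega)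
      have := h.chain.row_le (Nat.zero_le t) (by omega)
      omega
    | succ n =>
      rw [corner_apply_succ (isRook_pushed hS h.chain), corner_apply_succ hS,
        skeleton_pushed hS h hI]
      exact DFunLike.congr_fun (ih (isRook_skeleton hS) (hI.leastChain hS h)
        (by rwa [h0, h1])) n

/-- The modified second rule in the square where the `(n + 2)`-nd row appears. -/
theorem corner_ruleTwoMod_succ (hS : IsRook S) {n x y : ℕ}
    (hN : corner ruleTwo S x (y + 1) (n + 1) = 0) (hE : corner ruleTwo S (x + 1) y (n + 1) = 0)
    (h : corner ruleTwo S (x + 1) (y + 1) (n + 1) ≠ 0) :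
    corner (ruleTwoMod (n + 2)) S (x + 1) (y + 1) =
      corner ruleTwo S x (y + 1) + Finsupp.single 0 1 := by
  have hW : corner ruleTwo S x y (n + 1) = 0 := Nat.le_zero.mp (((step_up x y).le _).trans hN.le)
  have hNle : ∀ m, n + 1 ≤ m → corner ruleTwo S x (y + 1) m = 0 := fun m hm => by
    by_contra hne
    exact corner_apply_ne_zero_of_le hS hm hne hN
  have hle : ∀ m, m ≤ n + 1 → corner ruleTwo S (x + 1) (y + 1) m ≠ 0 := fun m hm =>
    corner_apply_ne_zero_of_le hS hm h
  rw [corner_succ, corner_ruleTwoMod hS hN, corner_ruleTwoMod hS hE, corner_ruleTwoMod hS hW]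
  rw [corner_succ] at h hle
  rcases northeast_cases ruleTwo ((x, y) ∈ S) (step_up x y) (step_right x y) with
    ⟨-, -, e⟩ | ⟨-, -, e⟩ | ⟨-, -, e⟩ | ⟨p, q, -, e1, e2, e⟩ | ⟨p, e1, e2, e⟩
  · rw [e] at h
    split_ifs at h <;> simp [hW] at h
  · rw [e] at h
    exact absurd hE h
  · rw [e] at h
    exact absurd hN h
  · rw [e] at h
    rw [e1] at hN
    rw [e2] at hE
    simp only [Finsupp.add_apply] at hN hE h
    omega
  · rw [e, e1, ruleTwo_add_single, ← e1] at h hle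
    -- The entry with index `n + 1` is new, so it is the one that rule 2 has just raised. Deleting
    -- it restores the northwest partition.
    have hp : p + 1 = n + 1 := by
      by_contra hne
      refine h ?_
      rw [Finsupp.add_apply, hN, Finsupp.single_apply, if_neg hne, add_zero]
    have hcard : (ruleTwo (corner ruleTwo S x y) (corner ruleTwo S x (y + 1))).support.card
        = n + 2 := by
      rw [e1, ruleTwo_add_single, ← e1, ← Finset.card_range (n + 2)]
      congr 1
      ext m
      rw [Finsupp.mem_support_iff, Finset.mem_range]
      constructor
      · intro hm
        by_contra hlt
        refine hm ?_
        rw [Finsupp.add_apply, hNle m (by omega), Finsupp.single_apply, if_neg (by omega),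
          add_zero]
      · exact fun hm => hle m (by omega)
    rw [northeast, e1, e2, if_neg (not_not.mpr rfl), if_pos (add_single_ne _ _), ← e1, ruleTwoMod,
      if_pos hcard]
    congr 1
    rw [e1, ruleTwo_add_single, ← e1, hp]
    ext m
    rw [Finsupp.erase_apply]
    split_ifs with hm
    · rw [hm]; exact hN.symm
    · rw [Finsupp.add_apply, Finsupp.single_apply, if_neg (by omega), add_zero]

/-- Partitions outside a rectangle are determined by those on its right and upper sides and the
markers outside it. -/
theorem corner_congr_outside {two : (ℕ →₀ ℕ) → (ℕ →₀ ℕ) → (ℕ →₀ ℕ)} {T : Finset (ℕ × ℕ)}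
    {i j : ℕ} (hout : ∀ a b, i < a ∨ j < b → ((a, b) ∈ S ↔ (a, b) ∈ T))
    (hup : ∀ x ≤ i + 1, corner two S x (j + 1) = corner two T x (j + 1))
    (hright : ∀ y ≤ j + 1, corner two S (i + 1) y = corner two T (i + 1) y) (x y : ℕ)
    (hxy : i < x ∨ j < y) : corner two S x y = corner two T x y := by
  induction x generalizing y with
  | zero => simp
  | succ x ihx =>
    induction y with
    | zero => simp
    | succ y ihy =>
      by_cases h1 : x = i ∧ y ≤ j
      · obtain ⟨rfl, hy⟩ := h1
        exact hright _ (by omega)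
      by_cases h2 : y = j ∧ x ≤ i
      · obtain ⟨rfl, hx⟩ := h2
        exact hup _ (by omega)
      have h3 : i < x ∨ j < y := by omega
      rw [corner_succ, corner_succ, ihx _ h3, ihx _ (by omega), ihy (by omega)]
      simp only [hout x y h3]

end GrowthDiagram

/-! ### Occurrences as chains, and invariance under a single replacement. -/

namespace RookPlacement

open GrowthDiagram

variable {F : YoungDiagram} {P : RookPlacement F} {n : ℕ}

theorem isRook_squares (P : RookPlacement F) : IsRook P.squares where
  col h h' := (Prod.ext_iff.mp (P.col_injOn h h' rfl)).2
  row h h' := (Prod.ext_iff.mp (P.row_injOn h h' rfl)).1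

theorem isOccurrence_of_decChain {E : ℕ → ℕ × ℕ} (hE : DecChain P.squares (n + 1) E)
    (hF : ((E n).1, (E 0).2) ∈ F) : P.IsOccurrence fun t : Fin (n + 1) => E t := by
  refine ⟨fun t => hE.mem t t.2, fun s t hst => hE.col_lt hst t.2,
    fun s t hst => hE.row_lt hst t.2, 0, ((E n).1, (E 0).2), ?_, fun t => ?_⟩
  · intro p hp
    exact F.isLowerSet (Finset.mem_Icc.mp hp).2 hF
  · exact Finset.mem_Icc.mpr ⟨⟨Nat.zero_le _, Nat.zero_le _⟩,
      hE.col_le (Nat.le_of_lt_succ t.2) (by omega), hE.row_le (Nat.zero_le _) t.2⟩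

/-- An occurrence as a sequence indexed by the natural numbers. -/
def extend (D : Fin (n + 1) → ℕ × ℕ) (t : ℕ) : ℕ × ℕ := if h : t < n + 1 then D ⟨t, h⟩ else 0

theorem extend_of_lt (D : Fin (n + 1) → ℕ × ℕ) {t : ℕ} (h : t < n + 1) :
    extend D t = D ⟨t, h⟩ := dif_pos h

theorem IsOccurrence.decChain {D : Fin (n + 1) → ℕ × ℕ} (hD : P.IsOccurrence D) :
    DecChain P.squares (n + 1) (extend D) := by
  refine ⟨fun t ht => ?_, fun t ht => ?_, fun t ht => ?_⟩
  · rw [extend_of_lt D ht]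
    exact hD.mem _
  · rw [extend_of_lt D ht, extend_of_lt D (show t < n + 1 by omega)]
    exact hD.col_strictMono (Fin.mk_lt_mk.mpr (Nat.lt_succ_self t))
  · rw [extend_of_lt D ht, extend_of_lt D (show t < n + 1 by omega)]
    exact hD.row_strictAnti (Fin.mk_lt_mk.mpr (Nat.lt_succ_self t))

theorem IsOccurrence.corner_mem {D : Fin (n + 1) → ℕ × ℕ} (hD : P.IsOccurrence D) :
    ((extend D n).1, (extend D 0).2) ∈ F := by
  obtain ⟨u, v, huv, hD'⟩ := hD.rectangle
  rw [extend_of_lt D (show n < n + 1 by omega), extend_of_lt D (show 0 < n + 1 by omega)]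
  have h1 := Finset.mem_Icc.mp (hD' ⟨n, by omega⟩)
  have h2 := Finset.mem_Icc.mp (hD' ⟨0, by omega⟩)
  exact huv (Finset.mem_Icc.mpr ⟨⟨h1.1.1, h2.1.2⟩, h1.2.1, h2.2.2⟩)

/-- The markers in the smallest rectangle with southwest corner `(0, 0)` that contains the
sequence `E 0, …, E n`. -/
def window (P : RookPlacement F) (n : ℕ) (E : ℕ → ℕ × ℕ) : Finset (ℕ × ℕ) :=
  P.squares.filter fun p => p.1 ≤ (E n).1 ∧ p.2 ≤ (E 0).2

theorem mem_window {E : ℕ → ℕ × ℕ} {p : ℕ × ℕ} :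
    p ∈ P.window n E ↔ p ∈ P.squares ∧ p.1 ≤ (E n).1 ∧ p.2 ≤ (E 0).2 := Finset.mem_filter

theorem isRook_window (P : RookPlacement F) (n : ℕ) (E : ℕ → ℕ × ℕ) : IsRook (P.window n E) where
  col h h' := P.isRook_squares.col (mem_window.mp h).1 (mem_window.mp h').1
  row h h' := P.isRook_squares.row (mem_window.mp h).1 (mem_window.mp h').1

theorem IsOccurrence.decChain_window {D : Fin (n + 1) → ℕ × ℕ} (hD : P.IsOccurrence D) :
    DecChain (P.window n (extend D)) (n + 1) (extend D) :=
  hD.decChain.mono fun t ht => mem_window.mpr ⟨hD.decChain.mem t ht,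
    hD.decChain.col_le (Nat.le_of_lt_succ ht) (by omega), hD.decChain.row_le (Nat.zero_le t) ht⟩

theorem IsOccurrence.of_decChain_window {D : Fin (n + 1) → ℕ × ℕ} (hD : P.IsOccurrence D)
    {E : ℕ → ℕ × ℕ} (hE : DecChain (P.window n (extend D)) (n + 1) E) :
    P.IsOccurrence fun t : Fin (n + 1) => E t := by
  refine isOccurrence_of_decChain (hE.mono fun t ht => (mem_window.mp (hE.mem t ht)).1) ?_
  exact F.isLowerSet (show ((E n).1, (E 0).2) ≤ ((extend D n).1, (extend D 0).2) from
    ⟨(mem_window.mp (hE.mem n (by omega))).2.1, (mem_window.mp (hE.mem 0 (by omega))).2.2⟩)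
    hD.corner_mem

/-- Chains in the window are occurrences, since its northeast square is in `F`. A longer chain
without its first marker would start in a lower row than `D`. The meet of `D` with another chain has
no larger rows, so by minimality it has the same rows, hence the same squares. -/
theorem IsSmallestOccurrence.leastChain {D : Fin (n + 1) → ℕ × ℕ}
    (hD : P.IsSmallestOccurrence D) :
    LeastChain (P.window n (extend D)) (n + 1) (extend D) := by
  obtain ⟨hD, hmin⟩ := hD
  have hlong : ∀ E, ¬ DecChain (P.window n (extend D)) (n + 1 + 1) E := by
    intro E hE
    have hle := hmin _ (hD.of_decChain_window hE.tail)
    refine not_lt.mpr hle ⟨0, fun j hj => absurd hj (Nat.not_lt_zero _), ?_⟩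
    have h1 := hE.row 0 (by omega)
    have h2 := (mem_window.mp (hE.mem 0 (by omega))).2.2
    rw [extend_of_lt D (show 0 < n + 1 by omega)] at h2
    exact h1.trans_le h2
  refine ⟨hD.decChain_window, hlong, fun E hE t ht => ?_⟩
  obtain ⟨A, hA, hAE⟩ := hD.decChain_window.meet (P.isRook_window _ _) hE hlong
  have h1 := hmin _ (hD.of_decChain_window hA)
  have h2 : toLex (fun t : Fin (n + 1) => (A t).2) ≤ toLex fun t => (D t).2 := by
    refine Pi.toLex_monotone fun t => ?_
    have := (hAE t t.2).2.2.1
    rwa [extend_of_lt D t.2] at this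
  have h3 := congrFun (toLex.injective (le_antisymm h1 h2)) ⟨t, ht⟩
  have h4 : (extend D t).2 = (A t).2 := by rw [extend_of_lt D ht]; exact h3
  have h5 : ((extend D t).1, (extend D t).2) ∈ P.window n (extend D) :=
    hD.decChain_window.mem t ht
  rw [h4] at h5
  have h6 := (P.isRook_window _ _).row h5 (hA.mem t ht)
  have := hAE t ht
  omega

theorem mem_replaceOccurrence {D : Fin (n + 1) → ℕ × ℕ} (hD : P.IsOccurrence D) {x y : ℕ} :
    (x, y) ∈ (P.replaceOccurrence D hD).squares ↔
      (x, y) ∈ pushed P.squares (n + 1) (extend D) ∨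
        x = (extend D n).1 ∧ y = (extend D 0).2 := by
  have h1 : (x, y) ∉ Finset.univ.image D ↔
      ∀ t < n + 1, ¬ ((extend D t).1 = x ∧ (extend D t).2 = y) := by
    simp only [Finset.mem_image, Finset.mem_univ, true_and, not_exists]
    constructor
    · intro h t ht h'
      rw [extend_of_lt D ht] at h'
      exact h _ (Prod.ext h'.1 h'.2)
    · intro h t ht
      refine h t t.2 ?_
      rw [extend_of_lt D t.2]
      exact ⟨congrArg Prod.fst ht, congrArg Prod.snd ht⟩
  have h2 : (x, y) ∈ Finset.univ.image (shifted D) ↔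
      (∃ t, t + 1 < n + 1 ∧ (extend D t).1 = x ∧ (extend D (t + 1)).2 = y) ∨
        x = (extend D n).1 ∧ y = (extend D 0).2 := by
    simp only [Finset.mem_image, Finset.mem_univ, true_and, shifted, Prod.mk.injEq]
    constructor
    · rintro ⟨t, rfl, rfl⟩
      rcases Nat.lt_or_ge t.1 n with ht | ht
      · left
        refine ⟨t, by omega, by rw [extend_of_lt D t.2], ?_⟩
        rw [extend_of_lt D (show t.1 + 1 < n + 1 by omega)]
        congr 2
        exact (finRotate_of_lt ht).symm
      · right
        obtain rfl : t = Fin.last n := Fin.ext (by have := t.2; simp only [Fin.val_last]; omega)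
        rw [finRotate_last, extend_of_lt D (show n < n + 1 by omega),
          extend_of_lt D (show 0 < n + 1 by omega)]
        exact ⟨rfl, rfl⟩
    · rintro (⟨t, ht, rfl, rfl⟩ | ⟨rfl, rfl⟩)
      · refine ⟨⟨t, by omega⟩, by rw [extend_of_lt D (show t < n + 1 by omega)], ?_⟩
        rw [extend_of_lt D ht, finRotate_of_lt (by omega)]
      · refine ⟨Fin.last n, by rw [extend_of_lt D (show n < n + 1 by omega)]; rfl, ?_⟩
        rw [finRotate_last, extend_of_lt D (show 0 < n + 1 by omega)]
        rfl
  rw [mem_pushed, ← h1, or_assoc, ← h2]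
  simp only [replaceOccurrence, Finset.mem_union, Finset.mem_sdiff]

/-- On the upper and right sides of the rectangle, away from the northeast corner, both placements
have equal ordinary partitions with fewer than `n + 2` entries, so rule 2ₖ plays no role. The
northeast corner is compared directly; everything outside follows. -/
theorem corner_replaceOccurrence {D : Fin (n + 2) → ℕ × ℕ} (hD : P.IsSmallestOccurrence D)
    {x y : ℕ} (hxy : (x, y) ∉ F) :
    corner (ruleTwoMod (n + 2)) P.squares x y =
      corner (ruleTwoMod (n + 2)) (P.replaceOccurrence D hD.1).squares x y := by
  set E := extend D with hE
  set Q := P.window (n + 1) E with hQ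
  set T := (P.replaceOccurrence D hD.1).squares with hT
  have hS := P.isRook_squares
  have hTr : IsRook T := (P.replaceOccurrence D hD.1).isRook_squares
  have hL : LeastChain Q (n + 2) E := hD.leastChain
  have hQr : IsRook Q := P.isRook_window _ _
  have hchain : DecChain P.squares (n + 2) E := hD.1.decChain
  have memT : ∀ a b, (a, b) ∈ T ↔ (a, b) ∈ pushed P.squares (n + 2) E ∨
      a = (E (n + 1)).1 ∧ b = (E 0).2 := fun a b => mem_replaceOccurrence hD.1
  have hSQ : ∀ x ≤ (E (n + 1)).1 + 1, ∀ y ≤ (E 0).2 + 1,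
      corner ruleTwo P.squares x y = corner ruleTwo Q x y := fun x hx y hy =>
    corner_congr fun a ha b hb => by
      rw [hQ, mem_window]
      exact ⟨fun h => ⟨h, by dsimp only; omega, by dsimp only; omega⟩, fun h => h.1⟩
  have hTS : ∀ x y, x ≤ (E (n + 1)).1 ∧ y = (E 0).2 + 1 ∨
      x = (E (n + 1)).1 + 1 ∧ y ≤ (E 0).2 →
      corner ruleTwo T x y = corner ruleTwo P.squares x y := by
    intro x y hxy
    rw [hSQ x (by omega) y (by omega), ← corner_pushed hQr hL hxy]
    refine corner_congr fun a ha b hb => ?_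
    have hab : (a, b) ∈ Q ↔ (a, b) ∈ P.squares := by
      rw [hQ, mem_window]
      exact ⟨fun h => h.1, fun h => ⟨h, by dsimp only; omega, by dsimp only; omega⟩⟩
    rw [memT, or_iff_left (by omega), mem_pushed, mem_pushed, hab]
  -- As `E` is least, every chain of this length reaches its last column and its first row, hence is
  -- not southwest of these corners.
  have hzero : ∀ x y, x ≤ (E (n + 1)).1 ∧ y = (E 0).2 + 1 ∨
      x = (E (n + 1)).1 + 1 ∧ y ≤ (E 0).2 → corner ruleTwo P.squares x y (n + 1) = 0 := by
    intro x y hxy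
    rw [hSQ x (by omega) y (by omega)]
    by_contra hne
    obtain ⟨A, hA, hb⟩ := (corner_apply_ne_zero_iff hQr x y (n + 1)).mp hne
    have := hL.least A hA 0 (by omega)
    have := hL.least A hA (n + 1) (by omega)
    have := hb 0 (by omega)
    have := hb (n + 1) (by omega)
    omega
  have hbd : ∀ x y, x ≤ (E (n + 1)).1 ∧ y = (E 0).2 + 1 ∨
      x = (E (n + 1)).1 + 1 ∧ y ≤ (E 0).2 →
      corner (ruleTwoMod (n + 2)) P.squares x y = corner (ruleTwoMod (n + 2)) T x y := by
    intro x y hxy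
    rw [corner_ruleTwoMod hS (hzero x y hxy), corner_ruleTwoMod hTr, hTS x y hxy]
    rw [hTS x y hxy]
    exact hzero x y hxy
  have hNW := hzero (E (n + 1)).1 ((E 0).2 + 1) (Or.inl ⟨le_rfl, rfl⟩)
  have hSE := hzero ((E (n + 1)).1 + 1) (E 0).2 (Or.inr ⟨rfl, le_rfl⟩)
  have hNWT := hTS (E (n + 1)).1 ((E 0).2 + 1) (Or.inl ⟨le_rfl, rfl⟩)
  have hSET := hTS ((E (n + 1)).1 + 1) (E 0).2 (Or.inr ⟨rfl, le_rfl⟩)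
  -- For `P` this is the square where rule 2ₖ discards the new entry; for `T` it contains the added
  -- marker. Both add `1` to the first entry of the same partition.
  have hcorner : corner (ruleTwoMod (n + 2)) P.squares ((E (n + 1)).1 + 1) ((E 0).2 + 1) =
      corner (ruleTwoMod (n + 2)) T ((E (n + 1)).1 + 1) ((E 0).2 + 1) := by
    have hne : corner ruleTwo P.squares ((E (n + 1)).1 + 1) ((E 0).2 + 1) (n + 1) ≠ 0 := by
      rw [corner_apply_ne_zero_iff hS]
      exact ⟨E, hchain, fun t ht => ⟨Nat.lt_succ_of_le (hchain.col_le (by omega) (by omega)),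
        Nat.lt_succ_of_le (hchain.row_le (Nat.zero_le t) ht)⟩⟩
    have hmem : ((E (n + 1)).1, (E 0).2) ∈ T := (memT _ _).mpr (Or.inr ⟨rfl, rfl⟩)
    have e1 := hTr.corner_up_eq hmem
    have e2 := hTr.corner_right_eq hmem
    have z1 : corner ruleTwo T (E (n + 1)).1 ((E 0).2 + 1) (n + 1) = 0 := by rw [hNWT, hNW]
    have z2 : corner ruleTwo T ((E (n + 1)).1 + 1) (E 0).2 (n + 1) = 0 := by rw [hSET, hSE]
    have z3 : corner ruleTwo T (E (n + 1)).1 (E 0).2 (n + 1) = 0 := by rw [← e1, z1]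
    rw [corner_ruleTwoMod_succ hS hNW hSE hne, corner_succ, corner_ruleTwoMod hTr z1,
      corner_ruleTwoMod hTr z2, corner_ruleTwoMod hTr z3, e1, e2, ← hNWT, e1]
    simp [northeast, hmem]
  refine corner_congr_outside (i := (E (n + 1)).1) (j := (E 0).2) (fun a b hab => ?_)
    (fun x hx => ?_) (fun y hy => ?_) x y ?_
  · rw [memT, or_iff_left (by omega), mem_pushed]
    constructor
    · refine fun h => Or.inl ⟨h, ?_⟩
      rintro t ht ⟨rfl, rfl⟩
      have := hchain.col_le (Nat.le_of_lt_succ ht) (by omega)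
      have := hchain.row_le (Nat.zero_le t) ht
      omega
    · rintro (⟨h, -⟩ | ⟨t, ht, rfl, rfl⟩)
      · exact h
      · have := hchain.col_le (s := t) (t := n + 1) (by omega) (by omega)
        have := hchain.row_le (Nat.zero_le (t + 1)) ht
        omega
  · rcases eq_or_lt_of_le hx with rfl | hx
    · exact hcorner
    · exact hbd _ _ (Or.inl ⟨by omega, rfl⟩)
  · rcases eq_or_lt_of_le hy with rfl | hy
    · exact hcorner
    · exact hbd _ _ (Or.inr ⟨rfl, by omega⟩)
  · by_contra hcon
    exact hxy (F.isLowerSet (show (x, y) ≤ ((E (n + 1)).1, (E 0).2) from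
      ⟨by dsimp only; omega, by dsimp only; omega⟩) hD.1.corner_mem)

end RookPlacement

/-! ### The border of the board and the iteration of `φ`. -/

namespace GrowthDiagram

variable {F : YoungDiagram}

/-- The first half puts the corner beyond the rectangle of any occurrence; the second makes every
long enough decreasing chain southwest of it an occurrence. -/
theorem mem_border {c : ℕ × ℕ} (hc : c ∈ border F) :
    c ∉ F ∧ ∀ a < c.1, ∀ b < c.2, (a, b) ∈ F := by
  simp only [border, List.mem_cons, List.mem_flatMap, List.mem_range, List.mem_map,
    List.mem_reverse, List.mem_range'_1] at hc
  rcases hc with rfl | ⟨i, hi, j, ⟨hj1, hj2⟩, rfl⟩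
  · refine ⟨?_, fun a ha => absurd ha (Nat.not_lt_zero a)⟩
    rw [YoungDiagram.mem_iff_lt_rowLen]
    exact lt_irrefl _
  · refine ⟨?_, fun a ha b hb => ?_⟩
    · rw [YoungDiagram.mem_iff_lt_rowLen]
      omega
    · have h1 := F.rowLen_anti i (i + 1) (Nat.le_succ i)
      have h2 : (i, b) ∈ F := by
        rw [YoungDiagram.mem_iff_lt_rowLen]
        dsimp only at hb
        omega
      exact F.isLowerSet (show (a, b) ≤ (i, b) from ⟨Nat.le_of_lt_succ ha, le_rfl⟩) h2

theorem seqMod_phi {k : ℕ} (hk : 2 ≤ k) {P : RookPlacement F} (h : P.ContainsDecreasing k) :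
    seqMod k P = seqMod k (P.phi k) := by
  obtain ⟨n, rfl⟩ : ∃ n, k = n + 2 := ⟨k - 2, by omega⟩
  rw [RookPlacement.phi, dif_pos h]
  exact List.map_congr_left fun c hc => RookPlacement.corner_replaceOccurrence
    (RookPlacement.exists_smallestOccurrence h).choose_spec (mem_border hc).1

theorem seqMod_eq_seq {k : ℕ} (hk : 2 ≤ k) {P : RookPlacement F} (h : ¬ P.ContainsDecreasing k) :
    seqMod k P = seq P := by
  obtain ⟨n, rfl⟩ : ∃ n, k = n + 2 := ⟨k - 2, by omega⟩
  refine List.map_congr_left fun c hc => corner_ruleTwoMod P.isRook_squares ?_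
  by_contra hne
  obtain ⟨E, hE, hb⟩ := (corner_apply_ne_zero_iff P.isRook_squares _ _ _).mp hne
  exact h ⟨_, RookPlacement.isOccurrence_of_decChain hE
    ((mem_border hc).2 _ (hb (n + 1) (by omega)).1 _ (hb 0 (by omega)).2)⟩

theorem seqMod_eq_seq_phiStar {k : ℕ} (hk : 2 ≤ k) (P : RookPlacement F) :
    seqMod k P = seq (P.phiStar k hk) := by
  induction hw : P.weight using Nat.strong_induction_on generalizing P with
  | _ w ih =>
    rw [RookPlacement.phiStar]
    split_ifs with h
    · rw [seqMod_phi hk h]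
      exact ih _ (hw ▸ RookPlacement.weight_phi_lt hk h) _ rfl
    · exact seqMod_eq_seq hk h

end GrowthDiagram

theorem mainTheorem1 (k : ℕ) (hk : 2 ≤ k) (F : YoungDiagram) (P : RookPlacement F) :
    GrowthDiagram.seqMod k P = GrowthDiagram.seq (P.phiStar k hk) :=
  GrowthDiagram.seqMod_eq_seq_phiStar hk P
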